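/- **Setting.** Let $(X,d,\mu)$ be a metric measure space, i.e. a metric space with a Borel measure such that $0<\mu(B(x,r))<\infty$ for all open balls $B(x,r)$, $x\in X$, $r\in(0,\infty)$. For measurable $E\subseteq X$, $\mathcal P(E)$ is the class of measurable $q:E\to(0,\infty]$ with $\operatorname{ess\,inf}_E q>0$; $\mathcal P_b^{\log}(X)$ is the class of essentially bounded $p\in\mathcal P(X)$ such that, for some $C>0$, $\left|\frac1{p(x)}-\frac1{p(y)}\right|\le \frac{C}{\log(e+1/d(x,y))}$ for all $x,y\in X$. Write $f_E^-:=\operatorname{ess\,inf}_E f$, $f^+:=\operatorname{ess\,sup}_X f$, and $f\ll g$ if $\operatorname{ess\,inf}_X(g-f)>0$. With $\rho_{p(\cdot),E}(f):=\int_E|f(x)|^{p(x)}\,d\mu(x)$, the space $L^{p(\cdot)}(E)$ consists of the measurable $f$ with $\rho_{p(\cdot),E}(f)<\infty$ and has the Luxemburg quasi-norm $\|f\|_{L^{p(\cdot)}(E)}:=\inf\{\lambda>0:\rho_{p(\cdot),E}(f/\lambda)\le1\}$ (with $\inf\emptyset=\infty$). For a sequence $g=\{g_k\}_{k\in\mathbb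 Z}$ of measurable functions on $E$ and $q\in\mathcal P(E)$, let $$\|g\|_{L^{p(\cdot)}(\ell^{q(\cdot)}(E))}:=\Big\|\,\big\|\{g_k(x)\}_k\big\|_{\ell^{q(x)}}\Big\|_{L^{p(\cdot)}(E)},\qquad \|g\|_{\ell^{q(\cdot)}(L^{p(\cdot)}(E))}:=\inf\Big\{\lambda>0:\sum_{k\in\mathbb Z}\inf\big\{t>0:\rho_{p(\cdot),E}\big(\tfrac{g_k}{\lambda\, t^{1/q(\cdot)}}\big)\le1\big\}\le1\Big\},$$ with $t^{1/\infty}:=1$; the spaces $L^{p(\cdot)}(\ell^{q(\cdot)}(E))$ and $\ell^{q(\cdot)}(L^{p(\cdot)}(E))$ consist of the sequences with finite quasi-norm. For a measurable $u:E\to[-\infty,\infty]$ that is finite a.e., a sequence $g=\{g_k\}_{k\in\mathbb Z}$ of measurable functions $g_k:E\to[0,\infty]$ is a vector $s(\cdot)$-gradient of $u$ on $E$, $g\in\mathbb D^{s(\cdot)}(u)$, if there is a null set $N$ such that $$|u(x)-u(y)|\le d(x,y)^{s(x)}g_k(x)+d(x,y)^{s(y)}g_k(y)\quad\text{for all }k\in\mathbb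 Z,\ x,y\in E\setminus N\text{ with }2^{-k-1}\le d(x,y)<2^{-k}.$$ Then $u\in\dot M^{s(\cdot)}_{p(\cdot),q(\cdot)}(E)$ if $\inf_{g\in\mathbb D^{s(\cdot)}(u)}\|g\|_{L^{p(\cdot)}(\ell^{q(\cdot)}(E))}<\infty$, and $u\in\dot N^{s(\cdot)}_{p(\cdot),q(\cdot)}(E)$ if $\inf_{g\in\mathbb D^{s(\cdot)}(u)}\|g\|_{\ell^{q(\cdot)}(L^{p(\cdot)}(E))}<\infty$. **Theorem.** Let $(X,d,\mu)$ be a metric measure space, and let $Q,p,s\in\mathcal P_b^{\log}(X)$, $\delta\in(0,\infty)$, $b\in(0,1]$, $\sigma\in(1,\infty)$, with $\mu(B(x,r))\ge b\,r^{Q(x)}$ for all $x\in X$ and $r\in(0,\delta]$. In the following, $B_0:=B(x_0,r_0)$, $\sigma B_0:=B(x_0,\sigma r_0)$, and all constants are positive and depend only on $b,\delta,\sigma,p,s,Q$ (as functions on the metric space $(X,d)$; in particular not on $\mu$, the ball, $q$, $u$ or $g$). 1. If $sp\ll Q$, put $\gamma:=\frac{Qp}{Q-sp}$. There is a constant $C_S$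 such that for all balls $B_0$ with $0<r_0\le\delta/\sigma$, all $q\in\mathcal P(\sigma B_0)$, $u\in\dot M^{s(\cdot)}_{p(\cdot),q(\cdot)}(\sigma B_0)$ and $g\in\mathbb D^{s(\cdot)}(u)\cap L^{p(\cdot)}(\ell^{q(\cdot)}(\sigma B_0))$, $$\inf_{c\in\mathbb R}\|u-c\|_{L^{\gamma(\cdot)}(B_0)}\le C_S\left(\frac{\mu(B_0)}{r_0^{Q(x_0)}}\right)^{1/\gamma^-_{B_0}}\|g\|_{L^{p(\cdot)}(\ell^{q(\cdot)}(\sigma B_0))}.$$ 2. If $sp=Q$, there are constants $C_{MT1},C_{MT2}$ such that for all $B_0,q,u,g$ as in 1 with $\|g\|_{L^{p(\cdot)}(\ell^{q(\cdot)}(\sigma B_0))}>0$, the function $u$ is integrable on $B_0$ and, with $u_{B_0}:=\frac1{\mu(B_0)}\int_{B_0}u\,d\mu$, $$\frac1{\mu(B_0)}\int_{B_0}\exp\left(C_{MT1}\frac{|u(x)-u_{B_0}|}{\|g\|_{L^{p(\cdot)}(\ell^{q(\cdot)}(\sigma B_0))}}\right)d\mu(x)\le C_{MT2}.$$ 3.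 If $sp\gg Q$, put $\alpha:=s-\frac Qp$. There is a constant $C_H$ such that for all $B_0,q,u,g$ as in 1, the function $u$ is integrable on $B_0$, $$\|u-u_{B_0}\|_{L^\infty(B_0)}\le C_H\,r_0^{\alpha(x_0)}\,\|g\|_{L^{p(\cdot)}(\ell^{q(\cdot)}(\sigma B_0))},$$ and $u$ has a continuous representative $\tilde u$ on $B_0$ such that, for all $x,y\in B_0$, $$|\tilde u(x)-\tilde u(y)|\le D_H(r_0)\,\|g\|_{L^{p(\cdot)}(\ell^{q(\cdot)}(\sigma B_0))}\,d(x,y)^{\alpha(x)},\qquad D_H(r_0):=2^{\alpha^++1}C_H\left(\frac{\sigma\delta}{(\sigma-1)r_0}\right)^{\alpha^+}.$$ In addition, statements 1–3 remain valid, for those $q\in\mathcal P(\sigma B_0)$ with $q\le p$ on $\sigma B_0$, with $\dot M^{s(\cdot)}_{p(\cdot),q(\cdot)}$ replaced by $\dot N^{s(\cdot)}_{p(\cdot),q(\cdot)}$ and $L^{p(\cdot)}(\ell^{q(\cdot)})$ replaced by $\ell^{q(\cdot)}(L^{p(\cdot)})$. -/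

import Mathlib

open MeasureTheory Metric Set
open scoped ENNReal

namespace HajlaszVar

noncomputable section

/-! Functions with values in `[0, ∞]` are `ℝ≥0∞`-valued.  All function spaces below live on a set
`E ⊆ X`, regarded as a metric measure space with the restricted metric and the restricted measure;
a function on `E` is represented by any function on `X` that extends it.  Measurability is
measurability with respect to the completion (`AEMeasurable`). -/

/-- `(X, d, μ)` is a metric measure space: every ball of positive radius has positive and finite
measure. -/
def IsMetricMeasure {X : Type*} [MetricSpace X] [MeasurableSpace X] (μ : Measure X) : Prop :=
  ∀ (x : X) (r : ℝ), 0 < r → 0 < μ (ball x r) ∧ μ (ball x r) < ∞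

/-- The lower growth bound `μ (B(x, r)) ≥ b r ^ Q(x)` for all `x` and all `r ∈ (0, δ]`. -/
def LowerGrowth {X : Type*} [MetricSpace X] [MeasurableSpace X] (μ : Measure X)
    (Q : X → ℝ) (b δ : ℝ) : Prop :=
  ∀ (x : X) (r : ℝ), 0 < r → r ≤ δ → ENNReal.ofReal (b * r ^ Q x) ≤ μ (ball x r)

/-- Log-Hölder continuity: `|f x - f y| ≤ C / log (e + 1 / d(x, y))`
(for `x = y` the left-hand side vanishes). -/
def LogHolder {X : Type*} [MetricSpace X] (f : X → ℝ) : Prop :=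
  ∃ C : ℝ, 0 < C ∧ ∀ x y : X, |f x - f y| ≤ C / Real.log (Real.exp 1 + 1 / dist x y)

/-- The class `𝒫(E)`: measurable `q : E → (0, ∞]` with `ess inf q > 0`. -/
structure IsExponentOn {X : Type*} [MeasurableSpace X] (μ : Measure X) (E : Set X)
    (q : X → ℝ≥0∞) : Prop where
  aemeasurable : AEMeasurable q (μ.restrict E)
  pos : ∀ x ∈ E, 0 < q x
  essInf_pos : 0 < essInf q (μ.restrict E)

/-- The class `𝒫_b^log(X)`: measurable `p : X → (0, ∞)`, essentially bounded, essentially bounded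
away from `0`, with `1 / p` log-Hölder continuous. -/
structure IsBddLogExponent {X : Type*} [MetricSpace X] [MeasurableSpace X] (μ : Measure X)
    (p : X → ℝ) : Prop where
  aemeasurable : AEMeasurable p μ
  pos : ∀ x, 0 < p x
  ess_lower : ∃ c : ℝ, 0 < c ∧ ∀ᵐ x ∂μ, c ≤ p x
  ess_upper : ∃ C : ℝ, ∀ᵐ x ∂μ, p x ≤ C
  logHolder : LogHolder fun x => 1 / p x

/-- `f ≪ g`, that is `ess inf (g - f) > 0`. -/
def EssLT {X : Type*} [MeasurableSpace X] (μ : Measure X) (f g : X → ℝ) : Prop :=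
  ∃ c : ℝ, 0 < c ∧ ∀ᵐ x ∂μ, c ≤ g x - f x

/-- The modular `ρ_{p(·)}(f) = ∫_E f ^ p(x) dμ`. -/
def modular {X : Type*} [MeasurableSpace X] (μ : Measure X) (E : Set X) (p : X → ℝ)
    (f : X → ℝ≥0∞) : ℝ≥0∞ :=
  ∫⁻ x in E, f x ^ p x ∂μ

/-- The Luxemburg quasi-norm of `f` in `L^{p(·)}(E)` (equal to `∞` if the infimum is over `∅`). -/
def luxNorm {X : Type*} [MeasurableSpace X] (μ : Measure X) (E : Set X) (p : X → ℝ)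
    (f : X → ℝ≥0∞) : ℝ≥0∞ :=
  sInf {t : ℝ≥0∞ | 0 < t ∧ t < ∞ ∧ modular μ E p (fun x => f x / t) ≤ 1}

/-- `f ∈ L^{p(·)}(E)` (finiteness of the modular forces `f < ∞` almost everywhere). -/
def MemLvar {X : Type*} [MeasurableSpace X] (μ : Measure X) (E : Set X) (p : X → ℝ)
    (f : X → ℝ≥0∞) : Prop :=
  AEMeasurable f (μ.restrict E) ∧ modular μ E p f < ∞

/-- The `ℓ^q` quasi-norm of a sequence indexed by `ℤ`, for `q ∈ (0, ∞]`. -/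
def seqNorm (q : ℝ≥0∞) (a : ℤ → ℝ≥0∞) : ℝ≥0∞ :=
  if q = ∞ then ⨆ k, a k else (∑' k, a k ^ q.toReal) ^ (1 / q.toReal)

/-- The semi-modular of `ℓ^{q(·)}(L^{p(·)}(E))`:
`∑_k inf {t > 0 : ρ_{p(·)}(g_k / t ^ (1 / q(·))) ≤ 1}`, with `t ^ (1 / ∞) = 1`. -/
def besovModular {X : Type*} [MeasurableSpace X] (μ : Measure X) (E : Set X) (p : X → ℝ)
    (q : X → ℝ≥0∞) (g : ℤ → X → ℝ≥0∞) : ℝ≥0∞ :=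
  ∑' k, sInf {t : ℝ≥0∞ | 0 < t ∧ t < ∞ ∧
    modular μ E p (fun x => g k x / t ^ ((q x)⁻¹).toReal) ≤ 1}

/-- The two scales: Triebel-Lizorkin (`Ṁ`, built on `L^{p(·)}(ℓ^{q(·)})`) and
Besov (`Ṅ`, built on `ℓ^{q(·)}(L^{p(·)})`). -/
inductive Scale
  | triebelLizorkin
  | besov

/-- The quasi-norm of `L^{p(·)}(ℓ^{q(·)}(E))`, respectively of `ℓ^{q(·)}(L^{p(·)}(E))`. -/
def mixedNorm {X : Type*} [MeasurableSpace X] (A : Scale) (μ : Measure X) (E : Set X)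
    (p : X → ℝ) (q : X → ℝ≥0∞) (g : ℤ → X → ℝ≥0∞) : ℝ≥0∞ :=
  match A with
  | .triebelLizorkin => luxNorm μ E p fun x => seqNorm (q x) fun k => g k x
  | .besov => sInf {t : ℝ≥0∞ | 0 < t ∧ t < ∞ ∧ besovModular μ E p q (fun k x => g k x / t) ≤ 1}

/-- `g ∈ L^{p(·)}(ℓ^{q(·)}(E))`, respectively `g ∈ ℓ^{q(·)}(L^{p(·)}(E))`. -/
def MemMixed {X : Type*} [MeasurableSpace X] (A : Scale) (μ : Measure X) (E : Set X)
    (p : X → ℝ) (q : X → ℝ≥0∞) (g : ℤ → X → ℝ≥0∞) : Prop :=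
  match A with
  | .triebelLizorkin => MemLvar μ E p fun x => seqNorm (q x) fun k => g k x
  | .besov => (∀ k, MemLvar μ E p (g k)) ∧
      ∃ t : ℝ≥0∞, 0 < t ∧ t < ∞ ∧ besovModular μ E p q (fun k x => g k x / t) < ∞

/-- `g ∈ 𝔻^{s(·)}(u)` on `E`: the `g_k` are measurable with values in `[0, ∞]`, and off a null set
`|u(x) - u(y)| ≤ d(x,y)^{s(x)} g_k(x) + d(x,y)^{s(y)} g_k(y)`
whenever `2^{-k-1} ≤ d(x,y) < 2^{-k}`.  It is used for `u` finite almost everywhere, so the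
exceptional null set can absorb the points where `u` is infinite. -/
def IsVectorGradient {X : Type*} [MetricSpace X] [MeasurableSpace X] (μ : Measure X) (E : Set X)
    (s : X → ℝ) (u : X → EReal) (g : ℤ → X → ℝ≥0∞) : Prop :=
  (∀ k, AEMeasurable (g k) (μ.restrict E)) ∧
  ∃ N : Set X, μ N = 0 ∧ ∀ k : ℤ, ∀ x ∈ E \ N, ∀ y ∈ E \ N,
    (2 : ℝ) ^ (-k - 1) ≤ dist x y → dist x y < (2 : ℝ) ^ (-k) →
      ENNReal.ofReal |(u x).toReal - (u y).toReal| ≤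
        ENNReal.ofReal (dist x y ^ s x) * g k x + ENNReal.ofReal (dist x y ^ s y) * g k y

/-- The homogeneous quasi-semi-norm: the infimum of the mixed norms of all vector gradients. -/
def hajlaszSeminorm {X : Type*} [MetricSpace X] [MeasurableSpace X] (A : Scale) (μ : Measure X)
    (E : Set X) (s p : X → ℝ) (q : X → ℝ≥0∞) (u : X → EReal) : ℝ≥0∞ :=
  ⨅ (g : ℤ → X → ℝ≥0∞) (_ : IsVectorGradient μ E s u g), mixedNorm A μ E p q g

/-- `u ∈ Ṁ^{s(·)}_{p(·),q(·)}(E)`, respectively `u ∈ Ṅ^{s(·)}_{p(·),q(·)}(E)`: `u` is an extended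
real valued measurable function on `E`, finite almost everywhere, with finite semi-norm. -/
structure MemHajlasz {X : Type*} [MetricSpace X] [MeasurableSpace X] (A : Scale) (μ : Measure X)
    (E : Set X) (s p : X → ℝ) (q : X → ℝ≥0∞) (u : X → EReal) : Prop where
  aemeasurable : AEMeasurable u (μ.restrict E)
  finite_ae : ∀ᵐ x ∂(μ.restrict E), u x ≠ ⊤ ∧ u x ≠ ⊥
  seminorm_lt_top : hajlaszSeminorm A μ E s p q u < ∞

/-- The data quantified over after the constants: a ball `B(x₀, r₀)` with `0 < r₀ ≤ δ / σ`, an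
exponent `q ∈ 𝒫(B(x₀, σ r₀))` (with `q ≤ p` in the Besov case), a function `u` in the homogeneous
space over `B(x₀, σ r₀)`, and a vector gradient `g` of `u` in the mixed Lebesgue sequence space. -/
structure LocalData {X : Type*} [MetricSpace X] [MeasurableSpace X] (A : Scale) (μ : Measure X)
    (s p : X → ℝ) (δ σ : ℝ) (x₀ : X) (r₀ : ℝ) (q : X → ℝ≥0∞) (u : X → EReal)
    (g : ℤ → X → ℝ≥0∞) : Prop where
  radius_pos : 0 < r₀
  radius_le : r₀ ≤ δ / σ
  exponent : IsExponentOn μ (ball x₀ (σ * r₀)) q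
  exponent_le : A = Scale.besov → ∀ x ∈ ball x₀ (σ * r₀), q x ≤ ENNReal.ofReal (p x)
  mem_space : MemHajlasz A μ (ball x₀ (σ * r₀)) s p q u
  gradient : IsVectorGradient μ (ball x₀ (σ * r₀)) s u g
  gradient_mem : MemMixed A μ (ball x₀ (σ * r₀)) p q g

/-- The standing assumptions on the measure and the exponents. -/
structure Standing {X : Type*} [MetricSpace X] [MeasurableSpace X] (μ : Measure X)
    (Q p s : X → ℝ) (b δ : ℝ) : Prop where
  metricMeasure : IsMetricMeasure μ
  growth : LowerGrowth μ Q b δ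
  exponent_Q : IsBddLogExponent μ Q
  exponent_p : IsBddLogExponent μ p
  exponent_s : IsBddLogExponent μ s

end

end HajlaszVar

namespace HajlaszVar

/-! ### Log-Hölder continuous functions -/

/-! Only the scalar function `G = ⨆ k, g k` is needed. Both mixed norms control it: if `m` is a real
number strictly above the mixed norm, then `h = (G / m) ^ p` has integral at most `1` over the large
ball (`modular_iSup_le`). For the Besov scale this is where `q ≤ p` enters.

By Chebyshev and the lower growth of the measure, every ball of radius `ρ` inside the large ball
contains a good point `z` with `h z ≲ ρ ^ (-Q)`. This is recorded in `ChainData`; from there to the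
pointwise estimates no measure occurs. From `x`, move outward through good points in balls of radii
`ρ_j = ρ * 2 ^ (-j / Q x)`, starting at the first `J` for which `h x ≲ ρ_J ^ (-Q x) = 2 ^ J * ρ ^
(-Q x)`. By the gradient inequality a link at scale `j` costs at most a constant times `ρ_j ^ (s x -
Q x / p x)`. Log-Hölder continuity lets every exponent be frozen at `x`. The result is
`exists_chain`, where `2 ^ J ≲ 1 + h x * ρ ^ Q x`.

The three cases are the three behaviours of this geometric sum. If `s p < Q`, its last term
dominates and `|u - a| ^ γ ≲ r₀ ^ (-Q x₀) + h`. If `s p = Q`, it equals `J`, so `exp (c |u - a|) ≲ 1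
+ h * r₀ ^ Q x₀`. If `s p > Q`, it is bounded, and chains of length scale `dist x y` give Hölder
continuity. Integrating the first two bounds with `∫ h ≤ 1` gives the Sobolev and Moser-Trudinger
statements; density of the good set and continuous extension give the Morrey one. -/

lemma one_le_log_exp_one_add {d : ℝ} (hd : 0 ≤ d) : 1 ≤ Real.log (Real.exp 1 + 1 / d) := by
  have h : (0 : ℝ) ≤ 1 / d := by positivity
  calc (1 : ℝ) = Real.log (Real.exp 1) := (Real.log_exp 1).symm
    _ ≤ _ := Real.log_le_log (Real.exp_pos 1) (by linarith)

section LogHolder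

variable {X : Type*} [MetricSpace X] {f g : X → ℝ}

lemma LogHolder.continuous (hf : LogHolder f) : Continuous f := by
  obtain ⟨C, hC, h⟩ := hf
  -- Below distance `exp (-(C / ε))` the logarithm in the modulus exceeds `C / ε`.
  refine Metric.continuous_iff.2 fun x ε hε => ⟨Real.exp (-(C / ε)), Real.exp_pos _, fun y hy => ?_⟩
  rcases eq_or_ne y x with rfl | hne
  · simpa using hε
  have hd : 0 < dist y x := dist_pos.2 hne
  rw [Real.dist_eq]
  refine (h y x).trans_lt ?_
  have h1 : C / ε < Real.log (Real.exp 1 + 1 / dist y x) := by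
    rw [Real.lt_log_iff_exp_lt (by positivity)]
    have h2 : Real.exp (C / ε) < 1 / dist y x := by
      rw [lt_div_iff₀ hd, ← lt_div_iff₀' (Real.exp_pos _), one_div, ← Real.exp_neg]
      exact hy
    linarith [Real.exp_pos 1]
  have h3 : 0 < C / ε := by positivity
  rw [div_lt_iff₀ (h3.trans h1)]
  rwa [div_lt_iff₀' hε] at h1

lemma LogHolder.neg (hf : LogHolder f) : LogHolder fun x => -f x := by
  obtain ⟨C, hC, h⟩ := hf
  refine ⟨C, hC, fun x y => ?_⟩
  rw [← neg_sub', abs_neg]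
  exact h x y

lemma LogHolder.sub (hf : LogHolder f) (hg : LogHolder g) : LogHolder fun x => f x - g x := by
  obtain ⟨C, hC, h⟩ := hf
  obtain ⟨C', hC', h'⟩ := hg
  refine ⟨C + C', by positivity, fun x y => ?_⟩
  calc |f x - g x - (f y - g y)| = |(f x - f y) - (g x - g y)| := by ring_nf
    _ ≤ |f x - f y| + |g x - g y| := abs_sub _ _
    _ ≤ _ := by rw [add_div]; exact add_le_add (h x y) (h' x y)

lemma LogHolder.mul (hf : LogHolder f) (hg : LogHolder g) {A B : ℝ} (hA : ∀ x, |f x| ≤ A)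
    (hB : ∀ x, |g x| ≤ B) : LogHolder fun x => f x * g x := by
  obtain ⟨C, hC, h⟩ := hf
  obtain ⟨C', hC', h'⟩ := hg
  rcases isEmpty_or_nonempty X with hX | ⟨⟨x₀⟩⟩
  · exact ⟨1, one_pos, fun x => hX.elim x⟩
  have hA0 : 0 ≤ A := (abs_nonneg _).trans (hA x₀)
  have hB0 : 0 ≤ B := (abs_nonneg _).trans (hB x₀)
  refine ⟨A * C' + B * C + 1, by positivity, fun x y => ?_⟩
  have hl : 0 < Real.log (Real.exp 1 + 1 / dist x y) :=
    one_pos.trans_le (one_le_log_exp_one_add dist_nonneg)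
  calc |f x * g x - f y * g y| = |f x * (g x - g y) + g y * (f x - f y)| := by ring_nf
    _ ≤ |f x| * |g x - g y| + |g y| * |f x - f y| := by
        rw [← abs_mul, ← abs_mul]; exact abs_add_le _ _
    _ ≤ A * (C' / Real.log (Real.exp 1 + 1 / dist x y)) +
        B * (C / Real.log (Real.exp 1 + 1 / dist x y)) := by
        gcongr
        exacts [hA x, h' x y, hB y, h x y]
    _ ≤ (A * C' + B * C + 1) / Real.log (Real.exp 1 + 1 / dist x y) := by
        rw [mul_div_assoc', mul_div_assoc', ← add_div]
        exact div_le_div_of_nonneg_right (by linarith) hl.le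

lemma LogHolder.of_one_div (hf : LogHolder fun x => 1 / f x) (h0 : ∀ x, 0 < f x) {A : ℝ}
    (hA : ∀ x, f x ≤ A) : LogHolder f := by
  obtain ⟨C, hC, h⟩ := hf
  rcases isEmpty_or_nonempty X with hX | ⟨⟨x₀⟩⟩
  · exact ⟨1, one_pos, fun x => hX.elim x⟩
  have hA0 : 0 < A := (h0 x₀).trans_le (hA x₀)
  refine ⟨A * A * C, by positivity, fun x y => ?_⟩
  have hx := h0 x
  have hy := h0 y
  have hl : 0 < Real.log (Real.exp 1 + 1 / dist x y) :=
    one_pos.trans_le (one_le_log_exp_one_add dist_nonneg)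
  calc |f x - f y| = f x * f y * |1 / f x - 1 / f y| := by
        have e : f x - f y = -(f x * f y * (1 / f x - 1 / f y)) := by
          field_simp
          ring
        rw [e, abs_neg, abs_mul, abs_of_pos (mul_pos hx hy)]
    _ ≤ A * A * (C / Real.log (Real.exp 1 + 1 / dist x y)) := by
        gcongr
        exacts [hA x, hA y, h x y]
    _ = _ := by ring

/-- Log-Hölder continuity makes the powers `ρ ^ f x` and `ρ ^ f y` comparable for points at
distance `O(ρ)`. -/
lemma LogHolder.rpow_le (hf : LogHolder f) {R K : ℝ} (hK : 0 < K) :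
    ∃ C : ℝ, 1 ≤ C ∧ ∀ (x y : X) (ρ : ℝ), 0 < ρ → ρ ≤ R → dist x y ≤ K * ρ →
      ρ ^ f x ≤ C * ρ ^ f y := by
  obtain ⟨C, hC, h⟩ := hf
  refine ⟨Real.exp (C * (1 + |Real.log K| + |Real.log R|)),
    Real.one_le_exp (by positivity), fun x y ρ hρ hρR hd => ?_⟩
  rcases eq_or_ne x y with rfl | hne
  · exact le_mul_of_one_le_left (by positivity) (Real.one_le_exp (by positivity))
  have hd0 : 0 < dist x y := dist_pos.2 hne
  set l := Real.log (Real.exp 1 + 1 / dist x y) with hl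
  have hl1 : 1 ≤ l := one_le_log_exp_one_add hd0.le
  -- The bound `dist x y ≤ K * ρ` controls `-log ρ` by `l`, and `ρ ≤ R` controls `log ρ`. So `|log
  -- ρ|` is at most a multiple of `l`, which the modulus `C / l` cancels.
  have hlog : |Real.log ρ| ≤ (1 + |Real.log K| + |Real.log R|) * l := by
    have e1 : |Real.log K| ≤ |Real.log K| * l := le_mul_of_one_le_right (abs_nonneg _) hl1
    have e2 : |Real.log R| ≤ |Real.log R| * l := le_mul_of_one_le_right (abs_nonneg _) hl1
    have e3 : Real.log ρ ≤ |Real.log R| := (Real.log_le_log hρ hρR).trans (le_abs_self _)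
    have e4 : -Real.log ρ ≤ |Real.log K| + l := by
      have : -Real.log (K * ρ) ≤ l := by
        rw [← Real.log_inv]
        refine Real.log_le_log (by positivity) ?_
        have : (K * ρ)⁻¹ ≤ 1 / dist x y := by
          rw [one_div]; exact inv_anti₀ hd0 hd
        linarith [Real.exp_pos 1]
      rw [Real.log_mul hK.ne' hρ.ne'] at this
      linarith [le_abs_self (Real.log K)]
    rw [abs_le]
    constructor <;> nlinarith [abs_nonneg (Real.log K), abs_nonneg (Real.log R)]
  have hmain : Real.log ρ * (f x - f y) ≤ C * (1 + |Real.log K| + |Real.log R|) := by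
    calc Real.log ρ * (f x - f y) ≤ |Real.log ρ| * |f x - f y| := by
          rw [← abs_mul]; exact le_abs_self _
      _ ≤ ((1 + |Real.log K| + |Real.log R|) * l) * (C / l) := by
          gcongr
          exact h x y
      _ = _ := by field_simp
  rw [Real.rpow_def_of_pos hρ, Real.rpow_def_of_pos hρ, ← Real.exp_add]
  exact Real.exp_le_exp.2 (by linarith)

end LogHolder

/-- Exponents `Q`, `p`, `s` with values in `[lo, hi]`, log-Hölder continuous. -/
structure Exponents {X : Type*} [MetricSpace X] (Q p s : X → ℝ) (lo hi : ℝ) : Prop where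
  lo_pos : 0 < lo
  Q_mem : ∀ x, Q x ∈ Icc lo hi
  p_mem : ∀ x, p x ∈ Icc lo hi
  s_mem : ∀ x, s x ∈ Icc lo hi
  logHolder_Q : LogHolder Q
  logHolder_p : LogHolder fun x => 1 / p x
  logHolder_s : LogHolder s

/-! ### From essential bounds to pointwise bounds on the exponents -/

section Everywhere

variable {X : Type*} [MetricSpace X] [MeasurableSpace X] {μ : Measure X}

lemma IsMetricMeasure.isOpenPosMeasure (hμ : IsMetricMeasure μ) : μ.IsOpenPosMeasure := by
  refine ⟨fun U hU ⟨x, hx⟩ h0 => ?_⟩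
  obtain ⟨r, hr, hrU⟩ := Metric.isOpen_iff.1 hU x hx
  exact (hμ x r hr).1.ne' (measure_mono_null hrU h0)

/-- The open set where a continuous `f` is below `c` is null, hence empty, since balls have positive
measure. -/
lemma IsMetricMeasure.le_of_ae_le (hμ : IsMetricMeasure μ) {f : X → ℝ} (hf : Continuous f)
    {c : ℝ} (h : ∀ᵐ x ∂μ, c ≤ f x) (x : X) : c ≤ f x := by
  have := hμ.isOpenPosMeasure
  by_contra! hx
  have ho : IsOpen {y | f y < c} := isOpen_lt hf continuous_const
  have h0 : μ {y | f y < c} = 0 := by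
    simpa [ae_iff] using h
  have := (ho.measure_eq_zero_iff μ).1 h0
  exact (this ▸ (show x ∈ {y | f y < c} from hx) : x ∈ (∅ : Set X))

lemma IsBddLogExponent.continuous {p : X → ℝ} (hp : IsBddLogExponent μ p) : Continuous p := by
  have h := hp.logHolder.continuous.inv₀ fun x => (one_div_pos.2 (hp.pos x)).ne'
  convert h using 1
  ext x
  simp

lemma IsBddLogExponent.exists_bounds {p : X → ℝ} (hp : IsBddLogExponent μ p)
    (hμ : IsMetricMeasure μ) : ∃ c C : ℝ, 0 < c ∧ ∀ x, p x ∈ Icc c C := by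
  obtain ⟨c, hc, hl⟩ := hp.ess_lower
  obtain ⟨C, hu⟩ := hp.ess_upper
  refine ⟨c, C, hc, fun x => ⟨hμ.le_of_ae_le hp.continuous hl x, ?_⟩⟩
  have := hμ.le_of_ae_le (f := fun x => -p x) hp.continuous.neg (c := -C)
    (by filter_upwards [hu] with x hx; linarith) x
  linarith

/-- The conclusion no longer mentions `μ`. This is what makes the constants below independent of the
measure. -/
lemma Standing.exponents {Q p s : X → ℝ} {b δ : ℝ} (h : Standing μ Q p s b δ) :
    ∃ lo hi, Exponents Q p s lo hi := by
  obtain ⟨c₁, C₁, h₁, H₁⟩ := h.exponent_Q.exists_bounds h.metricMeasure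
  obtain ⟨c₂, C₂, h₂, H₂⟩ := h.exponent_p.exists_bounds h.metricMeasure
  obtain ⟨c₃, C₃, h₃, H₃⟩ := h.exponent_s.exists_bounds h.metricMeasure
  refine ⟨min c₁ (min c₂ c₃), max C₁ (max C₂ C₃), by positivity,
    fun x => ⟨?_, ?_⟩, fun x => ⟨?_, ?_⟩, fun x => ⟨?_, ?_⟩,
    h.exponent_Q.logHolder.of_one_div h.exponent_Q.pos fun x => (H₁ x).2,
    h.exponent_p.logHolder,
    h.exponent_s.logHolder.of_one_div h.exponent_s.pos fun x => (H₃ x).2⟩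
  all_goals simp [(H₁ x).1, (H₁ x).2, (H₂ x).1, (H₂ x).2, (H₃ x).1, (H₃ x).2]

lemma EssLT.forall {f g : X → ℝ} (h : EssLT μ f g) (hμ : IsMetricMeasure μ) (hf : Continuous f)
    (hg : Continuous g) : ∃ c : ℝ, 0 < c ∧ ∀ x, c ≤ g x - f x := by
  obtain ⟨c, hc, h⟩ := h
  exact ⟨c, hc, hμ.le_of_ae_le (hg.sub hf) h⟩

end Everywhere

section

/-! ### The chaining argument -/

/-- A function `u` on `D ⊆ U` with gradient `h ^ (1 / p)`, where `h` attains moderate values in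
every small ball. -/
structure ChainData {X : Type*} [MetricSpace X] (Q p s : X → ℝ) (b δ : ℝ) (U D : Set X)
    (u h : X → ℝ) : Prop where
  nonneg : ∀ x, 0 ≤ h x
  gradient : ∀ x ∈ D, ∀ y ∈ D,
    |u x - u y| ≤ dist x y ^ s x * h x ^ (1 / p x) + dist x y ^ s y * h y ^ (1 / p y)
  select : ∀ (y : X) (ρ L : ℝ), 0 < ρ → ρ ≤ δ → ball y ρ ⊆ U → 0 < L → 1 < L * (b * ρ ^ Q y) →
    ∃ z ∈ D, dist y z < ρ ∧ h z ≤ L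

variable {X : Type*} [MetricSpace X] {Q p s : X → ℝ} {lo hi b δ : ℝ}

lemma Exponents.hi_pos (hE : Exponents Q p s lo hi) (x : X) : 0 < hi :=
  hE.lo_pos.trans_le ((hE.Q_mem x).1.trans (hE.Q_mem x).2)

lemma Exponents.Q_pos (hE : Exponents Q p s lo hi) (x : X) : 0 < Q x :=
  hE.lo_pos.trans_le (hE.Q_mem x).1

lemma Exponents.p_pos (hE : Exponents Q p s lo hi) (x : X) : 0 < p x :=
  hE.lo_pos.trans_le (hE.p_mem x).1

lemma Exponents.s_pos (hE : Exponents Q p s lo hi) (x : X) : 0 < s x :=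
  hE.lo_pos.trans_le (hE.s_mem x).1

/-- One term of the gradient inequality at scale `ρ`, with the exponents at `z` replaced by those at
`x`: since `z` lies within `K * ρ` of `x`, log-Hölder continuity makes the exchange cost only a
constant. -/
lemma Exponents.gradient_term_le (hE : Exponents Q p s lo hi) {K A : ℝ} (hK : 1 ≤ K)
    (hA : 1 ≤ A) (R : ℝ) :
    ∃ C : ℝ, 0 < C ∧ ∀ (x z : X) (ρ d a : ℝ), 0 < ρ → ρ ≤ R → dist x z ≤ K * ρ →
      0 ≤ d → d ≤ 2 * K * ρ → 0 ≤ a → a ≤ A * ρ ^ (-Q x) →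
      d ^ s z * a ^ (1 / p z) ≤ C * ρ ^ (s x - Q x / p x) := by
  obtain ⟨C₁, hC₁, h₁⟩ := hE.logHolder_s.rpow_le (R := R) (K := K) (by positivity)
  obtain ⟨C₂, hC₂, h₂⟩ := hE.logHolder_p.rpow_le (R := R) (K := K) (by positivity)
  refine ⟨(2 * K) ^ hi * C₁ * (A ^ (1 / lo) * C₂ ^ hi), by positivity,
    fun x z ρ d a hρ hρR hxz hd hdK ha haA => ?_⟩
  have hsz := hE.s_pos z
  have hpz := hE.p_pos z
  have e1 : d ^ s z ≤ (2 * K) ^ hi * C₁ * ρ ^ s x := by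
    calc d ^ s z ≤ (2 * K * ρ) ^ s z := Real.rpow_le_rpow hd hdK hsz.le
      _ = (2 * K) ^ s z * ρ ^ s z := Real.mul_rpow (by positivity) hρ.le
      _ ≤ (2 * K) ^ hi * (C₁ * ρ ^ s x) := by
        gcongr
        · linarith
        · exact (hE.s_mem z).2
        · exact h₁ z x ρ hρ hρR (by rwa [dist_comm])
      _ = _ := by ring
  have e2 : a ^ (1 / p z) ≤ A ^ (1 / lo) * C₂ ^ hi * ρ ^ (-(Q x / p x)) := by
    calc a ^ (1 / p z) ≤ (A * ρ ^ (-Q x)) ^ (1 / p z) :=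
          Real.rpow_le_rpow ha haA (by positivity)
      _ = A ^ (1 / p z) * (ρ ^ (1 / p z)) ^ (-Q x) := by
          rw [Real.mul_rpow (by positivity) (by positivity), ← Real.rpow_mul hρ.le,
            ← Real.rpow_mul hρ.le, mul_comm (-Q x)]
      _ ≤ A ^ (1 / lo) * (C₂ ^ hi * ρ ^ (-(Q x / p x))) := by
          gcongr
          · exact hE.lo_pos
          · exact (hE.p_mem z).1
          -- The outer exponent `-Q x` is negative, so the comparison is needed as a lower bound for
          -- `ρ ^ (1 / p z)`.
          · have h3 : C₂⁻¹ * ρ ^ (1 / p x) ≤ ρ ^ (1 / p z) := by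
              rw [inv_mul_le_iff₀ (by positivity)]
              exact h₂ x z ρ hρ hρR hxz
            calc (ρ ^ (1 / p z)) ^ (-Q x) ≤ (C₂⁻¹ * ρ ^ (1 / p x)) ^ (-Q x) :=
                  Real.rpow_le_rpow_of_nonpos (by positivity) h3 (by linarith [hE.Q_pos x])
              _ = C₂ ^ Q x * ρ ^ (-(Q x / p x)) := by
                  rw [Real.mul_rpow (by positivity) (by positivity),
                    Real.inv_rpow (by positivity), Real.rpow_neg (by positivity), inv_inv,
                    ← Real.rpow_mul hρ.le]
                  congr 2
                  ring
              _ ≤ _ := by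
                  gcongr
                  exact (hE.Q_mem x).2
      _ = _ := by ring
  calc d ^ s z * a ^ (1 / p z)
      ≤ ((2 * K) ^ hi * C₁ * ρ ^ s x) * (A ^ (1 / lo) * C₂ ^ hi * ρ ^ (-(Q x / p x))) := by
        gcongr
    _ = (2 * K) ^ hi * C₁ * (A ^ (1 / lo) * C₂ ^ hi) * (ρ ^ s x * ρ ^ (-(Q x / p x))) := by ring
    _ = _ := by rw [← Real.rpow_add hρ, ← sub_eq_add_neg]

lemma Exponents.step (hE : Exponents Q p s lo hi) {K A : ℝ} (hK : 1 ≤ K) (hA : 1 ≤ A) (R : ℝ) :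
    ∃ C : ℝ, 0 < C ∧ ∀ (b δ : ℝ) (U D : Set X) (u h : X → ℝ), ChainData Q p s b δ U D u h →
      ∀ (x z w : X) (ρ : ℝ), 0 < ρ → ρ ≤ R → z ∈ D → w ∈ D → dist x z ≤ K * ρ →
      dist x w ≤ K * ρ → h z ≤ A * ρ ^ (-Q x) → h w ≤ A * ρ ^ (-Q x) →
      |u z - u w| ≤ C * ρ ^ (s x - Q x / p x) := by
  obtain ⟨C, hC, H⟩ := hE.gradient_term_le hK hA R
  refine ⟨2 * C, by positivity, fun b δ U D u h hd x z w ρ hρ hρR hz hw hxz hxw hhz hhw => ?_⟩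
  have hzw : dist z w ≤ 2 * K * ρ := by
    have := dist_triangle_left z w x
    linarith
  have e1 := H x z ρ (dist z w) (h z) hρ hρR hxz dist_nonneg hzw (hd.nonneg z) hhz
  have e2 := H x w ρ (dist z w) (h w) hρ hρR hxw dist_nonneg hzw (hd.nonneg w) hhw
  have := hd.gradient z hz w hw
  linarith

/-- The ratio between the sum of all radii in a chain and the largest of them. -/
noncomputable def chainRatio (hi : ℝ) : ℝ := (1 - (2 : ℝ) ^ (-1 / hi))⁻¹

lemma two_rpow_neg_lt_one {t : ℝ} (ht : 0 < t) : (2 : ℝ) ^ (-1 / t) < 1 :=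
  Real.rpow_lt_one_of_one_lt_of_neg one_lt_two (div_neg_of_neg_of_pos (by norm_num) ht)

lemma one_le_chainRatio (h : 0 < hi) : 1 ≤ chainRatio hi := by
  have h1 := two_rpow_neg_lt_one h
  have h2 : (0 : ℝ) < 2 ^ (-1 / hi) := by positivity
  rw [chainRatio, one_le_inv₀ (by linarith)]
  linarith

/-- This preserves the chain invariant: a point within `K * θ * ρ` of `x`, moved by less than `ρ`,
stays within `K * ρ`. The worst ratio `θ = 2 ^ (-1 / t)` occurs at `t = hi`. -/
lemma chainRatio_mul_add_one_le {t : ℝ} (ht : 0 < t) (h : t ≤ hi) :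
    chainRatio hi * 2 ^ (-1 / t) + 1 ≤ chainRatio hi := by
  have h1 := two_rpow_neg_lt_one (ht.trans_le h)
  have h2 : (2 : ℝ) ^ (-1 / t) ≤ 2 ^ (-1 / hi) := by
    apply Real.rpow_le_rpow_of_exponent_le one_le_two
    rw [neg_div, neg_div]
    exact neg_le_neg (one_div_le_one_div_of_le ht h)
  have h3 : chainRatio hi * (1 - (2 : ℝ) ^ (-1 / hi)) = 1 := inv_mul_cancel₀ (by linarith)
  have h4 := one_le_chainRatio (ht.trans_le h)
  nlinarith

/-- The ratio `2 ^ (-1 / t)` of consecutive radii is chosen so that the threshold `ρ ^ (-t)` for `h`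
doubles at each smaller scale. -/
lemma mul_pow_rpow_neg {ρ t : ℝ} (hρ : 0 < ρ) (ht : 0 < t) (J : ℕ) :
    (ρ * (2 ^ (-1 / t)) ^ J) ^ (-t) = ρ ^ (-t) * 2 ^ J := by
  rw [Real.mul_rpow hρ.le (by positivity), ← Real.rpow_natCast ((2 : ℝ) ^ (-1 / t)),
    ← Real.rpow_mul (zero_le_two (α := ℝ)), ← Real.rpow_mul (zero_le_two (α := ℝ)), ← Real.rpow_natCast]
  congr 2
  field_simp

lemma mul_pow_rpow {ρ t : ℝ} (hρ : 0 < ρ) (β : ℝ) (J : ℕ) :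
    (ρ * (2 ^ (-1 / t)) ^ J) ^ β = ρ ^ β * (2 ^ (-β / t)) ^ J := by
  rw [Real.mul_rpow hρ.le (by positivity), ← Real.rpow_natCast ((2 : ℝ) ^ (-1 / t)),
    ← Real.rpow_mul (zero_le_two (α := ℝ)), ← Real.rpow_mul (zero_le_two (α := ℝ)),
    ← Real.rpow_natCast ((2 : ℝ) ^ (-β / t)), ← Real.rpow_mul (zero_le_two (α := ℝ))]
  congr 2
  ring

/-- Every small ball contains a point with moderate `h`. -/
lemma Exponents.exists_moderate (hE : Exponents Q p s lo hi) (hb : 0 < b) (δ : ℝ) {K : ℝ}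
    (hK : 1 ≤ K) : ∃ Λ : ℝ, 1 ≤ Λ ∧
      ∀ (U D : Set X) (u h : X → ℝ), ChainData Q p s b δ U D u h →
      ∀ (x y : X) (ρ : ℝ), 0 < ρ → ρ ≤ δ → dist x y ≤ K * ρ → ball y ρ ⊆ U →
      ∃ z ∈ D, dist y z < ρ ∧ h z ≤ Λ * ρ ^ (-Q x) := by
  obtain ⟨C, hC, hQ⟩ := hE.logHolder_Q.rpow_le (R := δ) (K := K) (by positivity)
  -- The factor `2` produces the strict inequality that `select` requires.
  refine ⟨max 1 (2 * C / b), le_max_left _ _, fun U D u h hd x y ρ hρ hρδ hxy hU => ?_⟩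
  refine hd.select y ρ _ hρ hρδ hU (by positivity) ?_
  have h1 : 2 * C / b ≤ max 1 (2 * C / b) := le_max_right _ _
  have h2 := hQ x y ρ hρ hρδ hxy
  have h3 : ρ ^ (-Q x) * ρ ^ Q x = 1 := by
    rw [← Real.rpow_add hρ]; simp
  have hpos : 0 < ρ ^ (-Q x) := by positivity
  calc (1 : ℝ) < 2 * (ρ ^ (-Q x) * ρ ^ Q x) := by rw [h3]; norm_num
    _ ≤ 2 * (ρ ^ (-Q x) * (C * ρ ^ Q y)) := by gcongr
    _ = (2 * C / b) * ρ ^ (-Q x) * (b * ρ ^ Q y) := by field_simp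
    _ ≤ _ := by gcongr

/-- The bound on `2 ^ J` ties the number of links to `h x`; the sum is kept unevaluated because its
growth distinguishes the three cases. -/
lemma Exponents.exists_chain (hE : Exponents Q p s lo hi) (hb : 0 < b) (δ : ℝ) :
    ∃ Λ C : ℝ, 1 ≤ Λ ∧ 0 < C ∧
      ∀ (U D : Set X) (u h : X → ℝ), ChainData Q p s b δ U D u h →
      ∀ (x : X) (ρ : ℝ), 0 < ρ → ρ ≤ δ → ball x (chainRatio hi * ρ) ⊆ U → x ∈ D →
      ∃ z ∈ D, ∃ J : ℕ, dist x z ≤ chainRatio hi * ρ ∧ h z ≤ Λ * ρ ^ (-Q x) ∧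
        (2 : ℝ) ^ J ≤ 1 + 2 * (h x * ρ ^ Q x) ∧
        |u x - u z| ≤ C * (ρ ^ (s x - Q x / p x) *
          ∑ j ∈ Finset.range J, ((2 : ℝ) ^ (-(s x - Q x / p x) / Q x)) ^ j) := by
  rcases isEmpty_or_nonempty X with hX | ⟨⟨x₀⟩⟩
  · exact ⟨1, 1, le_rfl, one_pos, fun U D u h _ x => hX.elim x⟩
  have hK : 1 ≤ chainRatio hi := one_le_chainRatio (hE.hi_pos x₀)
  obtain ⟨Λ, hΛ, hsel⟩ := hE.exists_moderate hb δ hK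
  obtain ⟨C, hC, hstep⟩ := hE.step hK (show (1 : ℝ) ≤ 2 * Λ by linarith) δ
  refine ⟨Λ, C, hΛ, hC, fun U D u h hd x ρ hρ hρδ hU hxD => ?_⟩
  have hQ := hE.Q_pos x
  set K := chainRatio hi with hKdef
  set θ : ℝ := 2 ^ (-1 / Q x) with hθ
  have hθ0 : 0 < θ := by positivity
  have hθ1 : θ < 1 := two_rpow_neg_lt_one hQ
  have hKθ : K * θ + 1 ≤ K := chainRatio_mul_add_one_le hQ (hE.Q_mem x).2
  have hrad : ∀ J : ℕ, (ρ * θ ^ J) ^ (-Q x) = ρ ^ (-Q x) * 2 ^ J := mul_pow_rpow_neg hρ hQ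
  -- The induction moves outward: from a point `y` admissible at scale `J + 1`, one link leads to a
  -- good point `w` at the larger scale `J`, where the hypothesis applies.
  have key : ∀ J : ℕ, ∀ y ∈ D, dist x y ≤ K * (ρ * θ ^ J) → h y ≤ Λ * (ρ ^ (-Q x) * 2 ^ J) →
      ∃ z ∈ D, dist x z ≤ K * ρ ∧ h z ≤ Λ * ρ ^ (-Q x) ∧
        |u y - u z| ≤ C * (ρ ^ (s x - Q x / p x) *
          ∑ j ∈ Finset.range J, ((2 : ℝ) ^ (-(s x - Q x / p x) / Q x)) ^ j) := by
    intro J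
    induction J with
    | zero =>
      intro y hy hxy hhy
      exact ⟨y, hy, by simpa using hxy, by simpa using hhy, by simp⟩
    | succ J ih =>
      intro y hy hxy hhy
      have hρJ : 0 < ρ * θ ^ J := by positivity
      have hle : ρ * θ ^ J ≤ ρ := mul_le_of_le_one_right hρ.le (pow_le_one₀ hθ0.le hθ1.le)
      have hxy' : dist x y + ρ * θ ^ J ≤ K * (ρ * θ ^ J) := by
        rw [pow_succ] at hxy
        nlinarith
      have hxyK : dist x y ≤ K * (ρ * θ ^ J) := by linarith
      have hball : ball y (ρ * θ ^ J) ⊆ U := by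
        refine (ball_subset_ball' ?_).trans hU
        rw [dist_comm]
        have : K * (ρ * θ ^ J) ≤ K * ρ := by gcongr
        linarith
      obtain ⟨w, hw, hyw, hhw⟩ := hsel U D u h hd x y _ hρJ (hle.trans hρδ) hxyK hball
      have hxw : dist x w ≤ K * (ρ * θ ^ J) := by
        have := dist_triangle x y w
        linarith
      obtain ⟨z, hz, hxz, hhz, huz⟩ := ih w hw hxw (by rwa [hrad] at hhw)
      refine ⟨z, hz, hxz, hhz, ?_⟩
      -- The threshold for `y` belongs to the next smaller radius, which is twice the one at scale
      -- `J`; hence the constant `2 * Λ` fed to `step`.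
      have h1 : h y ≤ 2 * Λ * (ρ * θ ^ J) ^ (-Q x) := by
        rw [hrad]
        refine hhy.trans_eq ?_
        ring
      have h2 : h w ≤ 2 * Λ * (ρ * θ ^ J) ^ (-Q x) := by
        have : 0 < (ρ * θ ^ J) ^ (-Q x) := by positivity
        nlinarith
      have h3 := hstep b δ U D u h hd x y w _ hρJ (hle.trans hρδ) hy hw hxyK hxw h1 h2
      rw [mul_pow_rpow hρ] at h3
      rw [Finset.sum_range_succ]
      have := abs_sub_le (u y) (u w) (u z)
      linarith
  -- The chain starts at the least admissible `J`. Failure at `J - 1` bounds `2 ^ J` by `2 * h x * ρ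
  -- ^ Q x`; the summand `1` covers `J = 0`.
  have hex : ∃ J : ℕ, h x ≤ Λ * (ρ ^ (-Q x) * 2 ^ J) := by
    obtain ⟨J, hJ⟩ := pow_unbounded_of_one_lt (h x / (Λ * ρ ^ (-Q x))) (one_lt_two (α := ℝ))
    refine ⟨J, ?_⟩
    rw [div_lt_iff₀ (by positivity)] at hJ
    linarith
  classical
  have hJ := Nat.find_spec hex
  have hmin := fun j => Nat.find_min hex (m := j)
  set J := Nat.find hex
  obtain ⟨z, hz, hxz, hhz, huz⟩ := key J x hxD (by simp; positivity) hJ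
  refine ⟨z, hz, J, hxz, hhz, ?_, huz⟩
  have h0 : 0 ≤ h x * ρ ^ Q x := mul_nonneg (hd.nonneg x) (by positivity)
  rcases hJ' : J with _ | j
  · simp; linarith
  · have h1 := hmin j (by omega)
    push Not at h1
    have h3 : ρ ^ (-Q x) * ρ ^ Q x = 1 := by
      rw [← Real.rpow_add hρ]; simp
    have h4 : 1 * (ρ ^ (-Q x) * 2 ^ j) ≤ h x := (by gcongr : _ ≤ Λ * _).trans h1.le
    have h5 : (1 * (ρ ^ (-Q x) * 2 ^ j)) * ρ ^ Q x ≤ h x * ρ ^ Q x := by gcongr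
    have h6 : (1 * (ρ ^ (-Q x) * 2 ^ j)) * ρ ^ Q x = 2 ^ j := by
      linear_combination (2 ^ j : ℝ) * h3
    rw [h6] at h5
    rw [pow_succ]
    linarith

end

section

/-! ### Pointwise estimates -/

variable {X : Type*} [MetricSpace X] {Q p s : X → ℝ} {lo hi b δ σ : ℝ}

/-- The ratio between the largest radius of a chain and the radius of the ball. -/
noncomputable def startRatio (hi σ : ℝ) : ℝ := min 1 ((σ - 1) / chainRatio hi)

lemma startRatio_pos (hhi : 0 < hi) (hσ : 1 < σ) : 0 < startRatio hi σ :=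
  lt_min one_pos (div_pos (by linarith) (one_pos.trans_le (one_le_chainRatio hhi)))

lemma chainRatio_mul_startRatio_le (hhi : 0 < hi) : chainRatio hi * startRatio hi σ ≤ σ - 1 := by
  have h := one_pos.trans_le (one_le_chainRatio hhi)
  rw [mul_comm, ← le_div_iff₀ h]
  exact min_le_right _ _

lemma le_of_le_div {r₀ : ℝ} (hσ : 1 < σ) (hr : 0 < r₀) (h : r₀ ≤ δ / σ) : r₀ ≤ δ := by
  rw [le_div_iff₀ (by linarith)] at h
  nlinarith

lemma ball_chain_subset (hhi : 0 < hi) {x₀ x : X} {r₀ ρ : ℝ} (hr : 0 < r₀)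
    (hx : x ∈ ball x₀ r₀) (hρ : ρ ≤ startRatio hi σ * r₀) :
    ball x (chainRatio hi * ρ) ⊆ ball x₀ (σ * r₀) := by
  apply ball_subset_ball'
  have h1 := one_pos.trans_le (one_le_chainRatio hhi)
  have h2 : chainRatio hi * ρ ≤ chainRatio hi * (startRatio hi σ * r₀) := by gcongr
  have h3 : chainRatio hi * startRatio hi σ * r₀ ≤ (σ - 1) * r₀ := by
    gcongr
    exact chainRatio_mul_startRatio_le hhi
  have h4 : dist x x₀ < r₀ := hx
  nlinarith

/-- All chains end at a scale comparable to `r₀`, so their endpoints can be joined by one more link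
to a single good point `w` near `x₀`. The value at `w` serves as `a`, and the extra link is the `1`
added to the sum. -/
lemma Exponents.exists_center (hE : Exponents Q p s lo hi) (hb : 0 < b) (hσ : 1 < σ) :
    ∃ C : ℝ, 0 < C ∧ ∀ (D : Set X) (u h : X → ℝ) (x₀ : X) (r₀ : ℝ), 0 < r₀ → r₀ ≤ δ / σ →
      ChainData Q p s b δ (ball x₀ (σ * r₀)) D u h →
      ∃ a : ℝ, ∀ x ∈ D, x ∈ ball x₀ r₀ → ∃ J : ℕ,
        (2 : ℝ) ^ J ≤ 1 + 2 * (h x * (startRatio hi σ * r₀) ^ Q x) ∧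
        |u x - a| ≤ C * ((startRatio hi σ * r₀) ^ (s x - Q x / p x) *
          (1 + ∑ j ∈ Finset.range J, ((2 : ℝ) ^ (-(s x - Q x / p x) / Q x)) ^ j)) := by
  rcases isEmpty_or_nonempty X with hX | ⟨⟨x₁⟩⟩
  · exact ⟨1, one_pos, fun D u h x => hX.elim x⟩
  have hhi := hE.hi_pos x₁
  set K := chainRatio hi with hKdef
  set η := startRatio hi σ with hηdef
  have hη : 0 < η := startRatio_pos hhi hσ
  have hη1 : η ≤ 1 := min_le_left _ _
  have hK : 1 ≤ K := one_le_chainRatio hhi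
  obtain ⟨Λ, C₁, hΛ, hC₁, hchain⟩ := hE.exists_chain hb δ
  obtain ⟨Λ', hΛ', hmod⟩ := hE.exists_moderate hb δ hK
  -- In units of `η * r₀`, the term `2 / η` is the diameter bound `2 * r₀` and `K` is the reach of a
  -- chain.
  have hM : 1 ≤ K + 2 / η := by
    have : 0 < 2 / η := by positivity
    linarith
  obtain ⟨B, hB, hQ⟩ := hE.logHolder_Q.neg.rpow_le (R := δ) (K := K + 2 / η) (by positivity)
  obtain ⟨C₂, hC₂, hstep⟩ := hE.step hM (show 1 ≤ Λ + Λ' * B by nlinarith) δ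
  refine ⟨C₁ + C₂, by positivity, fun D u h x₀ r₀ hr hrδ hd => ?_⟩
  have hrδ' := le_of_le_div hσ hr hrδ
  have hρ : 0 < η * r₀ := by positivity
  have hρr : η * r₀ ≤ r₀ := mul_le_of_le_one_left hr.le hη1
  have hρδ : η * r₀ ≤ δ := hρr.trans hrδ'
  have hx₀ : ball x₀ (K * (η * r₀)) ⊆ ball x₀ (σ * r₀) :=
    ball_chain_subset hhi hr (mem_ball_self hr) le_rfl
  obtain ⟨w, hw, hxw, hhw⟩ := hmod _ D u h hd x₀ x₀ (η * r₀) hρ hρδ (by simp; positivity)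
    ((ball_subset_ball (by nlinarith)).trans hx₀)
  refine ⟨u w, fun x hx hxB => ?_⟩
  obtain ⟨z, hz, J, hxz, hhz, hJ, huz⟩ := hchain _ D u h hd x (η * r₀) hρ hρδ
    (ball_chain_subset hhi hr hxB le_rfl) hx
  refine ⟨J, hJ, ?_⟩
  have hxB' : dist x x₀ < r₀ := hxB
  have e0 : 2 / η * (η * r₀) = 2 * r₀ := by field_simp
  have e1 : dist x x₀ ≤ (K + 2 / η) * (η * r₀) := by
    rw [add_mul, e0]
    nlinarith
  have e2 : dist x w ≤ (K + 2 / η) * (η * r₀) := by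
    have := dist_triangle x x₀ w
    rw [add_mul, e0]
    nlinarith
  have e3 : dist x z ≤ (K + 2 / η) * (η * r₀) := by
    rw [add_mul, e0]
    linarith
  have hp : 0 < (η * r₀) ^ (-Q x) := by positivity
  have e4 : h z ≤ (Λ + Λ' * B) * (η * r₀) ^ (-Q x) := by
    refine hhz.trans ?_
    gcongr
    have : 0 ≤ Λ' * B := by positivity
    linarith
  have e5 : h w ≤ (Λ + Λ' * B) * (η * r₀) ^ (-Q x) := by
    have := hQ x₀ x (η * r₀) hρ hρδ (by rwa [dist_comm])
    calc h w ≤ Λ' * (η * r₀) ^ (-Q x₀) := hhw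
      _ ≤ Λ' * (B * (η * r₀) ^ (-Q x)) := by gcongr
      _ ≤ _ := by nlinarith
  have h1 := hstep b δ _ D u h hd x z w _ hρ hρδ hz hw e3 e2 e4 e5
  have h2 := abs_sub_le (u x) (u z) (u w)
  set S := ∑ j ∈ Finset.range J, ((2 : ℝ) ^ (-(s x - Q x / p x) / Q x)) ^ j
  have hS : 0 ≤ S := Finset.sum_nonneg fun _ _ => by positivity
  set P := (η * r₀) ^ (s x - Q x / p x)
  have hP : 0 < P := by positivity
  calc |u x - u w| ≤ C₁ * (P * S) + C₂ * P := by linarith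
    _ ≤ C₁ * (P * S) + C₂ * P + (C₁ * P + C₂ * (P * S)) := by
        have : 0 ≤ C₁ * P + C₂ * (P * S) := by positivity
        linarith
    _ = _ := by ring

lemma Exponents.radius_rpow_le (hE : Exponents Q p s lo hi) {η : ℝ} (hη : 0 < η)
    (hη1 : η ≤ 1) (R : ℝ) :
    ∃ C : ℝ, 1 ≤ C ∧ ∀ (x₀ x : X) (r₀ : ℝ), 0 < r₀ → r₀ ≤ R → x ∈ ball x₀ r₀ →
      (η * r₀) ^ Q x ≤ C * r₀ ^ Q x₀ ∧ (η * r₀) ^ (-Q x) ≤ C * r₀ ^ (-Q x₀) := by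
  rcases isEmpty_or_nonempty X with hX | ⟨⟨x₁⟩⟩
  · exact ⟨1, le_rfl, fun x => hX.elim x⟩
  have hhi := hE.hi_pos x₁
  obtain ⟨C, hC, hQ⟩ := hE.logHolder_Q.rpow_le (R := R) one_pos
  obtain ⟨C', hC', hQ'⟩ := hE.logHolder_Q.neg.rpow_le (R := R) one_pos
  have hη2 : 1 ≤ η ^ (-hi) := Real.one_le_rpow_of_pos_of_le_one_of_nonpos hη hη1 (by linarith)
  refine ⟨C + η ^ (-hi) * C', by nlinarith, fun x₀ x r₀ hr hrR hx => ?_⟩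
  have hd : dist x x₀ ≤ 1 * r₀ := by rw [one_mul]; exact (mem_ball.1 hx).le
  have h1 := hQ x x₀ r₀ hr hrR hd
  have h2 := hQ' x x₀ r₀ hr hrR hd
  have hQx := hE.Q_pos x
  constructor
  · calc (η * r₀) ^ Q x ≤ r₀ ^ Q x :=
          Real.rpow_le_rpow (by positivity) (mul_le_of_le_one_left hr.le hη1) hQx.le
      _ ≤ C * r₀ ^ Q x₀ := h1
      _ ≤ _ := by
          gcongr
          have : 0 ≤ η ^ (-hi) * C' := by positivity
          linarith
  · calc (η * r₀) ^ (-Q x) = η ^ (-Q x) * r₀ ^ (-Q x) := Real.mul_rpow hη.le hr.le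
      _ ≤ η ^ (-hi) * (C' * r₀ ^ (-Q x₀)) := by
          have h3 : η ^ (-Q x) ≤ η ^ (-hi) :=
            Real.rpow_le_rpow_of_exponent_ge hη hη1 (neg_le_neg (hE.Q_mem x).2)
          exact mul_le_mul h3 h2 (by positivity) (by positivity)
      _ ≤ _ := by
          rw [← mul_assoc]
          gcongr
          linarith

lemma one_add_geom_sum_le {τ τ₀ : ℝ} (hτ₀ : 1 < τ₀) (h : τ₀ ≤ τ) (J : ℕ) :
    1 + ∑ j ∈ Finset.range J, τ ^ j ≤ (1 + 1 / (τ₀ - 1)) * τ ^ J := by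
  have h1 : 1 ≤ τ ^ J := one_le_pow₀ (by linarith)
  rw [geom_sum_eq (by linarith)]
  have h2 : (τ ^ J - 1) / (τ - 1) ≤ τ ^ J / (τ₀ - 1) := by
    have : 0 < τ₀ - 1 := by linarith
    gcongr
    linarith
  rw [add_mul, one_mul, div_mul_eq_mul_div, one_mul]
  linarith

/-- Here `s - Q / p = -Q / γ`, so the sum has ratio `2 ^ (1 / γ) > 1` and is comparable to `2 ^ (J /
γ)`. Raising to the power `γ` leaves `ρ ^ (-Q x) * 2 ^ J`, which the bound on `2 ^ J` turns into `ρ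
^ (-Q x) + 2 * h x`. -/
lemma Exponents.sobolev_pointwise (hE : Exponents Q p s lo hi) (hb : 0 < b) (hσ : 1 < σ)
    {c : ℝ} (hc : 0 < c) (hQ : ∀ x, c ≤ Q x - s x * p x) :
    ∃ C : ℝ, 1 ≤ C ∧ ∀ (D : Set X) (u h : X → ℝ) (x₀ : X) (r₀ : ℝ), 0 < r₀ → r₀ ≤ δ / σ →
      ChainData Q p s b δ (ball x₀ (σ * r₀)) D u h →
      ∃ a : ℝ, ∀ x ∈ D, x ∈ ball x₀ r₀ →
        |u x - a| ^ (Q x * p x / (Q x - s x * p x)) ≤ C * (r₀ ^ (-Q x₀) + h x) := by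
  rcases isEmpty_or_nonempty X with hX | ⟨⟨x₁⟩⟩
  · exact ⟨1, le_rfl, fun D u h x => hX.elim x⟩
  have hhi := hE.hi_pos x₁
  set η := startRatio hi σ with hηdef
  have hη : 0 < η := startRatio_pos hhi hσ
  have hη1 : η ≤ 1 := min_le_left _ _
  obtain ⟨C₁, hC₁, hcen⟩ := hE.exists_center (δ := δ) hb hσ
  obtain ⟨C₂, hC₂, hrad⟩ := hE.radius_rpow_le hη hη1 δ
  -- A lower bound for the ratio `2 ^ (1 / γ)` uniform in `x`, from `γ ≤ hi * hi / c`.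
  set τ₀ : ℝ := 2 ^ (c / (hi * hi)) with hτ₀
  have hτ₀1 : 1 < τ₀ := Real.one_lt_rpow one_lt_two (by positivity)
  have hτ₀' : 0 < τ₀ - 1 := by linarith
  set C₃ := max 1 (C₁ * (1 + 1 / (τ₀ - 1))) with hC₃
  have hC₃1 : 1 ≤ C₃ := le_max_left _ _
  have hC₃2 : C₁ * (1 + 1 / (τ₀ - 1)) ≤ C₃ := le_max_right _ _
  have hC₃3 : 1 ≤ C₃ ^ (hi * hi / c) := Real.one_le_rpow hC₃1 (by positivity)
  refine ⟨C₃ ^ (hi * hi / c) * (C₂ + 2), by nlinarith, fun D u h x₀ r₀ hr hrδ hd => ?_⟩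
  obtain ⟨a, ha⟩ := hcen D u h x₀ r₀ hr hrδ hd
  refine ⟨a, fun x hx hxB => ?_⟩
  obtain ⟨J, hJ, hux⟩ := ha x hx hxB
  have hrad' := (hrad x₀ x r₀ hr (le_of_le_div hσ hr hrδ) hxB).2
  have hp := hE.p_pos x
  have hQx := hE.Q_pos x
  have hsub : 0 < Q x - s x * p x := hc.trans_le (hQ x)
  set γ := Q x * p x / (Q x - s x * p x) with hγ
  have hγ0 : 0 < γ := by positivity
  have hγhi : γ ≤ hi * hi / c := by
    rw [hγ]
    gcongr
    exacts [(hE.Q_mem x).2, (hE.p_mem x).2, hQ x]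
  have hβ : s x - Q x / p x = -Q x * (1 / γ) := by
    rw [hγ]
    field_simp
    ring
  have hτ : -(s x - Q x / p x) / Q x = 1 / γ := by
    rw [hβ]; field_simp
  rw [hτ, hβ] at hux
  have hρ : 0 < η * r₀ := by positivity
  have hh := hd.nonneg x
  have hgeom := one_add_geom_sum_le hτ₀1 (τ := 2 ^ (1 / γ)) (by
    apply Real.rpow_le_rpow_of_exponent_le one_le_two
    rw [← one_div_div]
    exact one_div_le_one_div_of_le hγ0 hγhi) J
  have hpow : ((2 : ℝ) ^ (1 / γ)) ^ J = ((2 : ℝ) ^ J) ^ (1 / γ) := by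
    rw [← Real.rpow_natCast, ← Real.rpow_natCast, ← Real.rpow_mul zero_le_two,
      ← Real.rpow_mul zero_le_two, mul_comm]
  have hone : (η * r₀) ^ (-Q x) * (η * r₀) ^ Q x = 1 := by
    rw [← Real.rpow_add hρ]; simp
  have hub : |u x - a| ≤ C₃ * ((η * r₀) ^ (-Q x) + 2 * h x) ^ (1 / γ) := by
    calc |u x - a| ≤ _ := hux
      _ ≤ C₁ * ((η * r₀) ^ (-Q x * (1 / γ)) * ((1 + 1 / (τ₀ - 1)) * ((2 : ℝ) ^ (1 / γ)) ^ J)) := by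
          gcongr
      _ = C₁ * (1 + 1 / (τ₀ - 1)) * ((η * r₀) ^ (-Q x) * 2 ^ J) ^ (1 / γ) := by
          rw [hpow, Real.rpow_mul hρ.le, Real.mul_rpow (x := (η * r₀) ^ (-Q x)) (by positivity)
            (by positivity)]
          ring
      _ ≤ C₃ * ((η * r₀) ^ (-Q x) * (1 + 2 * (h x * (η * r₀) ^ Q x))) ^ (1 / γ) := by
          gcongr
      _ = _ := by
          congr 2
          linear_combination (2 * h x) * hone
  calc |u x - a| ^ γ ≤ (C₃ * ((η * r₀) ^ (-Q x) + 2 * h x) ^ (1 / γ)) ^ γ :=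
        Real.rpow_le_rpow (abs_nonneg _) hub hγ0.le
    _ = C₃ ^ γ * ((η * r₀) ^ (-Q x) + 2 * h x) := by
        rw [Real.mul_rpow (by positivity) (by positivity), ← Real.rpow_mul (by positivity),
          one_div_mul_cancel hγ0.ne', Real.rpow_one]
    _ ≤ C₃ ^ (hi * hi / c) * (C₂ * r₀ ^ (-Q x₀) + 2 * h x) := by gcongr
    _ ≤ C₃ ^ (hi * hi / c) * ((C₂ + 2) * (r₀ ^ (-Q x₀) + h x)) := by
        gcongr
        have : 0 < r₀ ^ (-Q x₀) := by positivity
        nlinarith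
    _ = _ := by ring

lemma Exponents.moserTrudinger_pointwise (hE : Exponents Q p s lo hi) (hb : 0 < b) (hσ : 1 < σ)
    (hQ : ∀ x, s x * p x = Q x) :
    ∃ c C : ℝ, 0 < c ∧ 0 < C ∧ ∀ (D : Set X) (u h : X → ℝ) (x₀ : X) (r₀ : ℝ), 0 < r₀ →
      r₀ ≤ δ / σ → ChainData Q p s b δ (ball x₀ (σ * r₀)) D u h →
      ∃ a : ℝ, ∀ x ∈ D, x ∈ ball x₀ r₀ →
        Real.exp (c * |u x - a|) ≤ C * (1 + h x * r₀ ^ Q x₀) := by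
  rcases isEmpty_or_nonempty X with hX | ⟨⟨x₁⟩⟩
  · exact ⟨1, 1, one_pos, one_pos, fun D u h x => hX.elim x⟩
  have hhi := hE.hi_pos x₁
  obtain ⟨C₁, hC₁, hcen⟩ := hE.exists_center (δ := δ) hb hσ
  obtain ⟨C₂, hC₂, hrad⟩ := hE.radius_rpow_le (startRatio_pos hhi hσ) (min_le_left _ _) δ
  have hlog := Real.log_pos one_lt_two
  -- All links cost the same, so `|u x - a| ≤ C₁ * (1 + J)`. This rate makes the exponential at most
  -- `2 ^ (J + 1)`, to which the bound on `2 ^ J` applies.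
  refine ⟨Real.log 2 / C₁, 4 * C₂, by positivity, by positivity,
    fun D u h x₀ r₀ hr hrδ hd => ?_⟩
  obtain ⟨a, ha⟩ := hcen D u h x₀ r₀ hr hrδ hd
  refine ⟨a, fun x hx hxB => ?_⟩
  obtain ⟨J, hJ, hux⟩ := ha x hx hxB
  have hrad' := (hrad x₀ x r₀ hr (le_of_le_div hσ hr hrδ) hxB).1
  have hp := hE.p_pos x
  have hβ : s x - Q x / p x = 0 := by
    rw [← hQ x]; field_simp; simp
  rw [hβ] at hux
  simp only [Real.rpow_zero, neg_zero, zero_div, one_pow, Finset.sum_const, Finset.card_range,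
    nsmul_eq_mul, mul_one, one_mul] at hux
  have h1 : Real.log 2 / C₁ * |u x - a| ≤ Real.log 2 * ((J + 1 : ℕ) : ℝ) := by
    calc Real.log 2 / C₁ * |u x - a| ≤ Real.log 2 / C₁ * (C₁ * (1 + J)) := by gcongr
      _ = _ := by push_cast; field_simp; ring
  have hh := hd.nonneg x
  calc Real.exp (Real.log 2 / C₁ * |u x - a|) ≤ Real.exp (Real.log 2 * ((J + 1 : ℕ) : ℝ)) :=
        Real.exp_le_exp.2 h1
    _ = 2 ^ (J + 1) := by
        rw [← Real.rpow_def_of_pos two_pos, Real.rpow_natCast]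
    _ = 2 * 2 ^ J := by ring
    _ ≤ 2 * (1 + 2 * (h x * (C₂ * r₀ ^ Q x₀))) := by
        gcongr
        exact hJ.trans (by gcongr)
    _ ≤ _ := by
        have : 0 ≤ h x * r₀ ^ Q x₀ := by positivity
        nlinarith

lemma geom_sum_le_inv {τ τ₀ : ℝ} (hτ : 0 ≤ τ) (h : τ ≤ τ₀) (hτ₀ : τ₀ < 1) (J : ℕ) :
    ∑ j ∈ Finset.range J, τ ^ j ≤ (1 - τ₀)⁻¹ := by
  calc ∑ j ∈ Finset.range J, τ ^ j ≤ ∑' j, τ ^ j :=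
        (summable_geometric_of_lt_one hτ (h.trans_lt hτ₀)).sum_le_tsum _
          fun _ _ => by positivity
    _ = (1 - τ)⁻¹ := tsum_geometric_of_lt_one hτ (h.trans_lt hτ₀)
    _ ≤ _ := inv_anti₀ (by linarith) (by linarith)

lemma Exponents.logHolder_smoothness (hE : Exponents Q p s lo hi) :
    LogHolder fun x => s x - Q x / p x := by
  have h := hE.logHolder_s.sub (hE.logHolder_Q.mul hE.logHolder_p (A := hi) (B := 1 / lo)
    (fun x => by rw [abs_of_pos (hE.Q_pos x)]; exact (hE.Q_mem x).2)
    (fun x => by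
      rw [abs_of_pos (one_div_pos.2 (hE.p_pos x))]
      exact one_div_le_one_div_of_le hE.lo_pos (hE.p_mem x).1))
  simpa only [mul_one_div] using h

lemma Exponents.smoothness_le (hE : Exponents Q p s lo hi) (x : X) : s x - Q x / p x ≤ hi := by
  have h1 := (hE.s_mem x).2
  have h2 : 0 < Q x / p x := div_pos (hE.Q_pos x) (hE.p_pos x)
  linarith

/-- One chain starts at `x`, another at `y`, both ending at a scale proportional to `dist x y`. A
positive smoothness exponent makes both sums bounded however large `h x` and `h y` are, and one link
joins the endpoints. -/
lemma Exponents.morrey_pointwise (hE : Exponents Q p s lo hi) (hb : 0 < b) (hσ : 1 < σ)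
    {c : ℝ} (hc : 0 < c) (hα : ∀ x, c ≤ s x - Q x / p x) :
    ∃ C : ℝ, 0 < C ∧ ∀ (D : Set X) (u h : X → ℝ) (x₀ : X) (r₀ : ℝ), 0 < r₀ → r₀ ≤ δ / σ →
      ChainData Q p s b δ (ball x₀ (σ * r₀)) D u h →
      ∀ x ∈ D, x ∈ ball x₀ r₀ → ∀ y ∈ D, y ∈ ball x₀ r₀ →
        |u x - u y| ≤ C * dist x y ^ (s x - Q x / p x) := by
  rcases isEmpty_or_nonempty X with hX | ⟨⟨x₁⟩⟩
  · exact ⟨1, one_pos, fun D u h x => hX.elim x⟩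
  have hhi := hE.hi_pos x₁
  set K := chainRatio hi with hKdef
  set η := startRatio hi σ with hηdef
  have hη : 0 < η := startRatio_pos hhi hσ
  have hη1 : η ≤ 1 := min_le_left _ _
  have hK : 1 ≤ K := one_le_chainRatio hhi
  obtain ⟨Λ, C₁, hΛ, hC₁, hchain⟩ := hE.exists_chain hb δ
  have hM : 1 ≤ K + 2 / η := by
    have : 0 < 2 / η := by positivity
    linarith
  obtain ⟨B, hB, hQ⟩ := hE.logHolder_Q.neg.rpow_le (R := δ) (K := K + 2 / η) (by positivity)
  obtain ⟨B', hB', hα'⟩ := hE.logHolder_smoothness.rpow_le (R := δ) (K := K + 2 / η)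
    (by positivity)
  obtain ⟨C₂, hC₂, hstep⟩ := hE.step hM (show 1 ≤ Λ * B by nlinarith) δ
  set τ₀ : ℝ := 2 ^ (-(c / hi)) with hτ₀
  have hτ₀1 : τ₀ < 1 := Real.rpow_lt_one_of_one_lt_of_neg one_lt_two
    (by rw [neg_lt_zero]; positivity)
  have hG : 0 < (1 - τ₀)⁻¹ := inv_pos.2 (by linarith)
  set G := (1 - τ₀)⁻¹
  refine ⟨C₁ * G + C₂ + C₁ * (B' * G), by positivity,
    fun D u h x₀ r₀ hr hrδ hd x hx hxB y hy hyB => ?_⟩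
  rcases eq_or_ne x y with rfl | hne
  · simp only [sub_self, abs_zero]
    positivity
  have hdist : 0 < dist x y := dist_pos.2 hne
  have hdist2 : dist x y < 2 * r₀ := by
    have := dist_triangle_right x y x₀
    have h1 := mem_ball.1 hxB
    have h2 := mem_ball.1 hyB
    linarith
  set ρ := η / 2 * dist x y with hρdef
  have hρ : 0 < ρ := by positivity
  have hρ1 : ρ ≤ η * r₀ := by rw [hρdef]; nlinarith
  have hρδ : ρ ≤ δ := by
    have := le_of_le_div hσ hr hrδ
    nlinarith
  have hτ : ∀ x, (2 : ℝ) ^ (-(s x - Q x / p x) / Q x) ≤ τ₀ := by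
    intro x
    apply Real.rpow_le_rpow_of_exponent_le one_le_two
    rw [neg_div, neg_le_neg_iff]
    have h1 := hα x
    have h2 := hE.Q_pos x
    have h3 := (hE.Q_mem x).2
    have h4 := hc.le.trans h1
    gcongr
  obtain ⟨z, hz, J, hxz, hhz, -, huz⟩ := hchain _ D u h hd x ρ hρ hρδ
    (ball_chain_subset hhi hr hxB hρ1) hx
  obtain ⟨w, hw, J', hyw, hhw, -, huw⟩ := hchain _ D u h hd y ρ hρ hρδ
    (ball_chain_subset hhi hr hyB hρ1) hy
  have e0 : 2 / η * ρ = dist x y := by rw [hρdef]; field_simp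
  have hKρ : 0 < K * ρ := by positivity
  have e1 : dist x y ≤ (K + 2 / η) * ρ := by rw [add_mul, e0]; linarith
  have e2 : dist x z ≤ (K + 2 / η) * ρ := by rw [add_mul, e0]; linarith
  have e3 : dist x w ≤ (K + 2 / η) * ρ := by
    have := dist_triangle x y w
    rw [add_mul, e0]; linarith
  have hpow : 0 < ρ ^ (-Q x) := by positivity
  have e4 : h z ≤ Λ * B * ρ ^ (-Q x) := by
    refine hhz.trans ?_
    gcongr
    exact le_mul_of_one_le_right (by positivity) hB
  have e5 : h w ≤ Λ * B * ρ ^ (-Q x) := by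
    have := hQ y x ρ hρ hρδ (by rwa [dist_comm])
    calc h w ≤ Λ * ρ ^ (-Q y) := hhw
      _ ≤ Λ * (B * ρ ^ (-Q x)) := by gcongr
      _ = _ := by ring
  have h1 := hstep b δ _ D u h hd x z w ρ hρ hρδ hz hw e2 e3 e4 e5
  have h2 : |u x - u z| ≤ C₁ * (ρ ^ (s x - Q x / p x) * G) :=
    huz.trans (mul_le_mul_of_nonneg_left (mul_le_mul_of_nonneg_left
      (geom_sum_le_inv (by positivity) (hτ x) hτ₀1 J) (by positivity)) hC₁.le)
  have h3 : |u y - u w| ≤ C₁ * (B' * ρ ^ (s x - Q x / p x) * G) := by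
    have h6 := hα' y x ρ hρ hρδ (by rwa [dist_comm])
    have h7 := geom_sum_le_inv (by positivity) (hτ y) hτ₀1 J'
    exact huw.trans (mul_le_mul_of_nonneg_left (mul_le_mul h6 h7
      (Finset.sum_nonneg fun _ _ => by positivity) (by positivity)) hC₁.le)
  have h4 : ρ ^ (s x - Q x / p x) ≤ dist x y ^ (s x - Q x / p x) := by
    have hαx := hc.le.trans (hα x)
    refine Real.rpow_le_rpow hρ.le ?_ hαx
    exact mul_le_of_le_one_left hdist.le (by linarith)
  have h5 : |u x - u y| ≤ |u x - u z| + |u z - u w| + |u y - u w| := by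
    have := abs_sub_le (u x) (u z) (u w)
    have := abs_sub_le (u x) (u w) (u y)
    rw [abs_sub_comm (u w)] at this
    linarith
  calc |u x - u y| ≤ C₁ * (ρ ^ (s x - Q x / p x) * G) + C₂ * ρ ^ (s x - Q x / p x) +
        C₁ * (B' * ρ ^ (s x - Q x / p x) * G) := h5.trans (add_le_add (add_le_add h2 h1) h3)
    _ = (C₁ * G + C₂ + C₁ * (B' * G)) * ρ ^ (s x - Q x / p x) := by ring
    _ ≤ _ := mul_le_mul_of_nonneg_left h4 (by positivity)

end

section

/-! ### Reduction to a scalar gradient -/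

lemma iSup_le_seqNorm {q : ℝ≥0∞} (hq : 0 < q) (a : ℤ → ℝ≥0∞) : ⨆ k, a k ≤ seqNorm q a := by
  unfold seqNorm
  split_ifs with h
  · exact le_rfl
  · have hq' : 0 < q.toReal := ENNReal.toReal_pos hq.ne' h
    refine iSup_le fun k => ?_
    calc a k = (a k ^ q.toReal) ^ (1 / q.toReal) := by
          rw [← ENNReal.rpow_mul, mul_one_div_cancel hq'.ne', ENNReal.rpow_one]
      _ ≤ _ := ENNReal.rpow_le_rpow (ENNReal.le_tsum k) (by positivity)

variable {X : Type*} [MeasurableSpace X] {μ : Measure X} {E : Set X} {p : X → ℝ} {q : X → ℝ≥0∞}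

lemma modular_mono_ae (hp : ∀ x, 0 < p x) {f g : X → ℝ≥0∞} (h : ∀ᵐ x ∂μ.restrict E, f x ≤ g x) :
    modular μ E p f ≤ modular μ E p g :=
  lintegral_mono_ae (h.mono fun x hx => ENNReal.rpow_le_rpow hx (hp x).le)

lemma ENNReal_mul_inv_add_one_le (S : ℝ≥0∞) : S * (S + 1)⁻¹ ≤ 1 := by
  rw [← div_eq_mul_inv]
  exact ENNReal.div_le_of_le_mul (by rw [one_mul]; exact le_self_add)

lemma luxNorm_lt_top {lo : ℝ} (hlo : 0 < lo) (hp : ∀ x, lo ≤ p x) {f : X → ℝ≥0∞}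
    (h : modular μ E p f < ∞) : luxNorm μ E p f < ∞ := by
  set S := modular μ E p f with hS
  have hS1 : (1 : ℝ≥0∞) ≤ S + 1 := le_add_self
  have hS2 : S + 1 ≠ ∞ := ENNReal.add_ne_top.2 ⟨h.ne, ENNReal.one_ne_top⟩
  -- As `t ≥ 1` and `p ≥ lo`, dividing by `t` shrinks the modular by at least the factor `S + 1`.
  set t := (S + 1) ^ (1 / lo) with ht
  have ht1 : 1 ≤ t := ENNReal.one_le_rpow hS1 (by positivity)
  have htop : t < ∞ := ENNReal.rpow_lt_top_of_nonneg (by positivity) hS2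
  refine lt_of_le_of_lt (b := t) (sInf_le ⟨one_pos.trans_le ht1, htop, ?_⟩) htop
  calc modular μ E p (fun x => f x / t) ≤ ∫⁻ x in E, f x ^ p x * (S + 1)⁻¹ ∂μ := by
        refine lintegral_mono fun x => ?_
        have hpx : 0 < p x := hlo.trans_le (hp x)
        simp only
        rw [ENNReal.div_rpow_of_nonneg _ _ hpx.le, div_eq_mul_inv]
        gcongr
        calc S + 1 = t ^ lo := by
              rw [ht, ← ENNReal.rpow_mul, one_div_mul_cancel hlo.ne', ENNReal.rpow_one]
          _ ≤ t ^ p x := ENNReal.rpow_le_rpow_of_exponent_le ht1 (hp x)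
    _ = S * (S + 1)⁻¹ := by
        rw [lintegral_mul_const' _ _ (ENNReal.inv_ne_top.2 (by positivity))]
        rfl
    _ ≤ 1 := ENNReal_mul_inv_add_one_le S

/-- A summand of the semi-modular of `ℓ^{q(·)}(L^{p(·)}(E))`. -/
noncomputable def besovTerm (μ : Measure X) (E : Set X) (p : X → ℝ) (q : X → ℝ≥0∞)
    (f : X → ℝ≥0∞) : ℝ≥0∞ :=
  sInf {t : ℝ≥0∞ | 0 < t ∧ t < ∞ ∧ modular μ E p (fun x => f x / t ^ ((q x)⁻¹).toReal) ≤ 1}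

/-- If `t` is admissible for `f`, then `c * t` is admissible for `f / l`: since `c ≤ 1` and `1 / q ≤
1 / ε`, one has `c ^ (1 / q) ≥ c ^ (1 / ε) ≥ 1 / l`. -/
lemma besovTerm_div_le (hp : ∀ x, 0 < p x) {ε : ℝ} (hε : 0 < ε)
    (hq : ∀ᵐ x ∂μ.restrict E, ENNReal.ofReal ε ≤ q x) {c l : ℝ≥0∞} (hc : 0 < c) (hc1 : c ≤ 1)
    (hl : 1 ≤ l * c ^ (1 / ε)) (f : X → ℝ≥0∞) :
    besovTerm μ E p q (fun x => f x / l) ≤ c * besovTerm μ E p q f := by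
  have hctop : c ≠ ∞ := ne_top_of_le_ne_top ENNReal.one_ne_top hc1
  conv_rhs => rw [besovTerm, sInf_eq_iInf, ENNReal.mul_iInf_of_ne hc.ne' hctop]
  refine le_iInf fun t => ?_
  rw [ENNReal.mul_iInf' (fun h => absurd h hctop) (fun h => absurd h hc.ne')]
  refine le_iInf fun ht => ?_
  obtain ⟨ht0, httop, hmod⟩ := ht
  refine sInf_le ⟨ENNReal.mul_pos hc.ne' ht0.ne', ENNReal.mul_lt_top hctop.lt_top httop, ?_⟩
  refine (modular_mono_ae hp ?_).trans hmod
  filter_upwards [hq] with x hx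
  have hinv : ((q x)⁻¹).toReal ≤ 1 / ε := by
    have h1 : (q x)⁻¹ ≤ ENNReal.ofReal (1 / ε) := by
      rw [one_div, ENNReal.ofReal_inv_of_pos hε]
      exact ENNReal.inv_le_inv.2 hx
    exact ENNReal.toReal_le_of_le_ofReal (by positivity) h1
  rw [ENNReal.mul_rpow_of_nonneg _ _ ENNReal.toReal_nonneg, div_eq_mul_inv, div_eq_mul_inv,
    div_eq_mul_inv, mul_assoc]
  gcongr
  have hl0 : l ≠ 0 := by
    rintro rfl
    simp at hl
  have hcp : c ^ ((q x)⁻¹).toReal ≠ ∞ := ENNReal.rpow_ne_top_of_nonneg ENNReal.toReal_nonneg hctop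
  have h2 : 1 ≤ l * c ^ ((q x)⁻¹).toReal :=
    hl.trans (mul_le_mul_right (ENNReal.rpow_le_rpow_of_exponent_ge hc1 hinv) l)
  rw [← ENNReal.mul_inv (Or.inl hl0) (Or.inr ?_), ENNReal.inv_le_inv, ← mul_assoc]
  · exact le_mul_of_one_le_left (zero_le) h2
  · refine mul_ne_zero ?_ ?_
    · exact (ENNReal.rpow_pos hc hctop).ne'
    · exact (ENNReal.rpow_pos ht0 httop.ne).ne'

/-- This is where `q ≤ p` enters: for admissible `t < 1`, `t ^ (p / q) ≤ t`, so pulling `t ^ (1 /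
q)` out of the modular leaves at least one full factor `t`. -/
lemma modular_le_besovTerm (hE : MeasurableSet E) (hp : ∀ x, 0 < p x) (hq0 : ∀ x ∈ E, 0 < q x)
    (hqp : ∀ x ∈ E, q x ≤ ENNReal.ofReal (p x)) {f : X → ℝ≥0∞} (h : besovTerm μ E p q f < 1) :
    modular μ E p f ≤ besovTerm μ E p q f := by
  refine le_of_forall_gt fun a ha => ?_
  obtain ⟨t, ⟨ht0, httop, hmod⟩, hta⟩ := sInf_lt_iff.1 (lt_min ha h)
  have ht1 : t < 1 := hta.trans_le (min_le_right _ _)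
  refine lt_of_le_of_lt ?_ (hta.trans_le (min_le_left _ _))
  calc modular μ E p f ≤ ∫⁻ x in E, (f x / t ^ ((q x)⁻¹).toReal) ^ p x * t ∂μ := by
        refine lintegral_mono_ae ((ae_restrict_iff' hE).2 (.of_forall fun x hx => ?_))
        have hpx := hp x
        set r := ((q x)⁻¹).toReal with hr
        have hr1 : 1 ≤ r * p x := by
          have h1 : (ENNReal.ofReal (p x))⁻¹ ≤ (q x)⁻¹ := ENNReal.inv_le_inv.2 (hqp x hx)
          have h2 := ENNReal.toReal_mono (ENNReal.inv_ne_top.2 (hq0 x hx).ne') h1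
          rw [ENNReal.toReal_inv, ENNReal.toReal_ofReal hpx.le] at h2
          rwa [inv_le_iff_one_le_mul₀ hpx] at h2
        have hr0 : 0 ≤ r := ENNReal.toReal_nonneg
        rw [ENNReal.div_rpow_of_nonneg _ _ hpx.le, ← ENNReal.rpow_mul, div_eq_mul_inv, mul_assoc]
        refine le_mul_of_one_le_right (zero_le) ?_
        have h3 : t ^ (r * p x) ≤ t := by
          conv_rhs => rw [← ENNReal.rpow_one t]
          exact ENNReal.rpow_le_rpow_of_exponent_ge ht1.le hr1
        rw [mul_comm, ← div_eq_mul_inv,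
          ENNReal.le_div_iff_mul_le (Or.inl (ENNReal.rpow_pos ht0 httop.ne).ne')
            (Or.inl (ENNReal.rpow_ne_top_of_nonneg (by positivity) httop.ne)), one_mul]
        exact h3
    _ = modular μ E p (fun x => f x / t ^ ((q x)⁻¹).toReal) * t :=
        lintegral_mul_const' _ _ httop.ne
    _ ≤ 1 * t := by gcongr
    _ = t := one_mul t

/-- The mixed norms dominate the norm of the largest component of the gradient. -/
lemma modular_iSup_le {A : Scale} (hE : MeasurableSet E) (hpm : Measurable p) {lo : ℝ}
    (hlo : 0 < lo) (hp : ∀ x, lo ≤ p x) (hq : IsExponentOn μ E q)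
    (hqp : A = Scale.besov → ∀ x ∈ E, q x ≤ ENNReal.ofReal (p x)) {g : ℤ → X → ℝ≥0∞}
    (hg : ∀ k, AEMeasurable (g k) (μ.restrict E)) (hmem : MemMixed A μ E p q g) :
    mixedNorm A μ E p q g < ∞ ∧ ∀ m : ℝ≥0∞, m ≠ ∞ → mixedNorm A μ E p q g < m →
      modular μ E p (fun x => (⨆ k, g k x) / m) ≤ 1 := by
  have hp0 : ∀ x, 0 < p x := fun x => hlo.trans_le (hp x)
  cases A with
  | triebelLizorkin =>
    refine ⟨luxNorm_lt_top hlo hp hmem.2, fun m _ hlt => ?_⟩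
    obtain ⟨t, ⟨_, _, hmod⟩, htm⟩ := sInf_lt_iff.1 hlt
    refine (modular_mono_ae hp0 ((ae_restrict_iff' hE).2 (.of_forall fun x hx => ?_))).trans hmod
    exact ENNReal.div_le_div (iSup_le_seqNorm (hq.pos x hx) _) htm.le
  | besov =>
    obtain ⟨ε, hε, hqε⟩ : ∃ ε : ℝ, 0 < ε ∧ ∀ᵐ x ∂μ.restrict E, ENNReal.ofReal ε ≤ q x := by
      obtain ⟨e, he0, he⟩ := exists_between hq.essInf_pos
      have hetop : e ≠ ∞ := (he.trans_le le_top).ne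
      refine ⟨e.toReal, ENNReal.toReal_pos he0.ne' hetop, ?_⟩
      rw [ENNReal.ofReal_toReal hetop]
      filter_upwards [ae_essInf_le (f := q) (μ := μ.restrict E)] with x hx
      exact he.le.trans hx
    constructor
    · obtain ⟨-, t, ht0, httop, hfin⟩ := hmem
      set S := besovModular μ E p q (fun k x => g k x / t) with hS
      have hS2 : S + 1 ≠ ∞ := ENNReal.add_ne_top.2 ⟨hfin.ne, ENNReal.one_ne_top⟩
      have hS0 : S + 1 ≠ 0 := by positivity
      set l := (S + 1) ^ (1 / ε) with hl
      have hl0 : l ≠ 0 := (ENNReal.rpow_pos (pos_iff_ne_zero.2 hS0) hS2).ne'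
      have hltop : l ≠ ∞ := ENNReal.rpow_ne_top_of_nonneg (by positivity) hS2
      have hlt : t * l < ∞ := ENNReal.mul_lt_top httop hltop.lt_top
      refine lt_of_le_of_lt (b := t * l) (sInf_le ⟨ENNReal.mul_pos ht0.ne' hl0, hlt, ?_⟩) hlt
      have hc1 : (S + 1)⁻¹ ≤ 1 := ENNReal.inv_le_one.2 le_add_self
      have hlc : 1 ≤ l * (S + 1)⁻¹ ^ (1 / ε) := by
        rw [ENNReal.inv_rpow, ENNReal.mul_inv_cancel hl0 hltop]
      calc besovModular μ E p q (fun k x => g k x / (t * l))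
          = ∑' k, besovTerm μ E p q (fun x => g k x / t / l) := by
            refine tsum_congr fun k => ?_
            unfold besovTerm
            simp only [div_eq_mul_inv, mul_assoc,
              ENNReal.mul_inv (Or.inl ht0.ne') (Or.inr hl0)]
        _ ≤ ∑' k, (S + 1)⁻¹ * besovTerm μ E p q (fun x => g k x / t) :=
            ENNReal.tsum_le_tsum fun k =>
              besovTerm_div_le hp0 hε hqε (ENNReal.inv_pos.2 hS2) hc1 hlc _
        _ = (S + 1)⁻¹ * S := by rw [ENNReal.tsum_mul_left]; rfl
        _ ≤ 1 := by rw [mul_comm]; exact ENNReal_mul_inv_add_one_le S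
    · intro m hmtop hlt
      obtain ⟨t, ⟨ht0, httop, hmod⟩, htm⟩ := sInf_lt_iff.1 hlt
      have hm0 : m ≠ 0 := (ht0.trans htm).ne'
      have htm1 : t / m < 1 := by
        rw [ENNReal.div_lt_iff (Or.inl hm0) (Or.inl hmtop), one_mul]
        exact htm
      -- The strict gap `t < m` yields `c < 1`, which pushes every summand strictly below `1`, as
      -- `modular_le_besovTerm` demands.
      set c := (t / m) ^ ε with hc
      have htm0 : 0 < t / m := ENNReal.div_pos ht0.ne' hmtop
      have hc0 : 0 < c := ENNReal.rpow_pos htm0 htm1.ne_top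
      have hc1 : c < 1 := ENNReal.rpow_lt_one htm1 hε
      have hlc : 1 ≤ m / t * c ^ (1 / ε) := by
        rw [hc, ← ENNReal.rpow_mul, mul_one_div_cancel hε.ne', ENNReal.rpow_one,
          ← ENNReal.inv_div (Or.inl hmtop) (Or.inl hm0),
          ENNReal.inv_mul_cancel htm0.ne' htm1.ne_top]
      have hterm : ∀ k, besovTerm μ E p q (fun x => g k x / m) ≤
          c * besovTerm μ E p q (fun x => g k x / t) := by
        intro k
        refine le_of_eq_of_le ?_ (besovTerm_div_le hp0 hε hqε hc0 hc1.le hlc _)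
        congr 1
        ext x
        rw [div_eq_mul_inv, div_eq_mul_inv, div_eq_mul_inv, ENNReal.inv_div (Or.inl httop.ne)
          (Or.inl ht0.ne'), mul_assoc, div_eq_mul_inv, ← mul_assoc t⁻¹,
          ENNReal.inv_mul_cancel ht0.ne' httop.ne, one_mul]
      have hlt1 : ∀ k, besovTerm μ E p q (fun x => g k x / m) < 1 := by
        intro k
        refine (hterm k).trans_lt (lt_of_le_of_lt ?_ hc1)
        refine mul_le_of_le_one_right (zero_le) ?_
        exact (ENNReal.le_tsum (f := fun k => besovTerm μ E p q (fun x => g k x / t)) k).trans hmod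
      calc modular μ E p (fun x => (⨆ k, g k x) / m)
          ≤ ∫⁻ x in E, ∑' k, (g k x / m) ^ p x ∂μ := by
            refine lintegral_mono fun x => ?_
            have hpx := hp0 x
            simp only
            rw [ENNReal.iSup_div]
            rw [← ENNReal.le_rpow_inv_iff hpx]
            refine iSup_le fun k => ?_
            rw [ENNReal.le_rpow_inv_iff hpx]
            exact ENNReal.le_tsum (f := fun k => (g k x / m) ^ p x) k
        _ = ∑' k, modular μ E p (fun x => g k x / m) :=
            lintegral_tsum fun k => ((hg k).div_const m).pow hpm.aemeasurable
        _ ≤ ∑' k, besovTerm μ E p q (fun x => g k x / m) :=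
            ENNReal.tsum_le_tsum fun k =>
              modular_le_besovTerm hE hp0 hq.pos (hqp rfl) (hlt1 k)
        _ ≤ ∑' k, besovTerm μ E p q (fun x => g k x / t) :=
            ENNReal.tsum_le_tsum fun k =>
              (hterm k).trans (mul_le_of_le_one_left (zero_le) hc1.le)
        _ ≤ 1 := hmod

end

/-! ### From the measure to chain data -/

section

/-- Chebyshev's inequality: `h` takes moderate values on sets of large measure. -/
lemma exists_le_of_one_lt_mul_measure {Y : Type*} [MeasurableSpace Y] {μ : Measure Y} {U D E : Set Y}
    (hD : μ (U \ D) = 0) (hE : MeasurableSet E) (hEU : E ⊆ U) {h : Y → ℝ}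
    (hint : ∫⁻ x in U, ENNReal.ofReal (h x) ∂μ ≤ 1) {L : ℝ}
    (hL : 1 < ENNReal.ofReal L * μ E) : ∃ z ∈ D, z ∈ E ∧ h z ≤ L := by
  by_contra! hcon
  refine (hL.trans_le ?_).false
  calc ENNReal.ofReal L * μ E = ∫⁻ _ in E, ENNReal.ofReal L ∂μ := by simp
    _ ≤ ∫⁻ x in E, ENNReal.ofReal (h x) ∂μ := by
        refine lintegral_mono_ae ((ae_restrict_iff' hE).2 ?_)
        have : ∀ᵐ x ∂μ, x ∉ U \ D := measure_eq_zero_iff_ae_notMem.1 hD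
        filter_upwards [this] with x hx hxE
        have hxD : x ∈ D := by
          by_contra hxD
          exact hx ⟨hEU hxE, hxD⟩
        exact ENNReal.ofReal_le_ofReal (hcon x hxD hxE).le
    _ ≤ ∫⁻ x in U, ENNReal.ofReal (h x) ∂μ := lintegral_mono_set hEU
    _ ≤ 1 := hint

variable {X : Type*} [MetricSpace X] [MeasurableSpace X] [BorelSpace X] {μ : Measure X}
  {Q p s : X → ℝ} {lo hi b δ σ : ℝ}

lemma exists_dyadic_scale {d : ℝ} (hd : 0 < d) :
    ∃ k : ℤ, (2 : ℝ) ^ (-k - 1) ≤ d ∧ d < (2 : ℝ) ^ (-k) := by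
  obtain ⟨n, h1, h2⟩ := exists_mem_Ico_zpow hd (one_lt_two (α := ℝ))
  exact ⟨-n - 1, by simpa using h1, by simpa [add_comm] using h2⟩

/-- The set `D` discards a null set once, before `m` is chosen. The parameter `m` stays strictly
above the mixed norm because the infimum need not be attained and may vanish. -/
lemma LocalData.exists_chainData {A : Scale} (hst : Standing μ Q p s b δ)
    (hE : Exponents Q p s lo hi) {x₀ : X} {r₀ : ℝ} {q : X → ℝ≥0∞} {u : X → EReal}
    {g : ℤ → X → ℝ≥0∞} (hl : LocalData A μ s p δ σ x₀ r₀ q u g) :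
    mixedNorm A μ (ball x₀ (σ * r₀)) p q g < ∞ ∧
      ∃ D : Set X, D ⊆ ball x₀ (σ * r₀) ∧ μ (ball x₀ (σ * r₀) \ D) = 0 ∧
        (∀ x ∈ D, u x ≠ ⊤ ∧ u x ≠ ⊥) ∧
        ∀ m : ℝ, mixedNorm A μ (ball x₀ (σ * r₀)) p q g < ENNReal.ofReal m →
          ∃ h : X → ℝ, ChainData Q p s b δ (ball x₀ (σ * r₀)) D (fun x => (u x).toReal / m) h ∧
            ∫⁻ x in ball x₀ (σ * r₀), ENNReal.ofReal (h x) ∂μ ≤ 1 := by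
  set U := ball x₀ (σ * r₀) with hU
  have hUm : MeasurableSet U := measurableSet_ball
  have hpm : Measurable p := hst.exponent_p.continuous.measurable
  have hp0 := hE.p_pos
  obtain ⟨hgm, N, hN, hgrad⟩ := hl.gradient
  obtain ⟨hfin, hmod⟩ := modular_iSup_le (A := A) hUm hpm hE.lo_pos (fun x => (hE.p_mem x).1)
    hl.exponent hl.exponent_le hgm hl.gradient_mem
  refine ⟨hfin, ?_⟩
  set G : X → ℝ≥0∞ := fun x => ⨆ k, g k x with hG
  have hGm : AEMeasurable G (μ.restrict U) := AEMeasurable.iSup hgm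
  have hGfin : ∀ᵐ x ∂μ.restrict U, G x ≠ ∞ := by
    obtain ⟨m, hm1, hm2⟩ := exists_between hfin
    have hm := hmod m hm2.ne hm1
    filter_upwards [ae_lt_top' ((hGm.div_const m).pow hpm.aemeasurable)
      (hm.trans_lt ENNReal.one_lt_top).ne] with x hx hGx
    rw [hGx, ENNReal.top_div_of_ne_top hm2.ne, ENNReal.top_rpow_of_pos (hp0 x)] at hx
    exact hx.false
  set D := {x | x ∈ U ∧ x ∉ N ∧ G x ≠ ∞ ∧ u x ≠ ⊤ ∧ u x ≠ ⊥} with hD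
  have hnull : μ (U \ D) = 0 := by
    have h1 := (ae_restrict_iff' hUm).1 hGfin
    have h2 := (ae_restrict_iff' hUm).1 hl.mem_space.finite_ae
    have h3 : ∀ᵐ x ∂μ, x ∉ N := measure_eq_zero_iff_ae_notMem.1 hN
    rw [measure_eq_zero_iff_ae_notMem]
    filter_upwards [h1, h2, h3] with x h1 h2 h3
    rintro ⟨hxU, hx⟩
    exact hx ⟨hxU, h3, h1 hxU, h2 hxU⟩
  refine ⟨D, fun x hx => hx.1, hnull, fun x hx => hx.2.2.2, fun m hm => ?_⟩
  have hm0 : 0 < m := ENNReal.ofReal_pos.1 ((zero_le).trans_lt hm)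
  have hmG := hmod _ ENNReal.ofReal_ne_top hm
  set h : X → ℝ := fun x => ((G x).toReal / m) ^ p x with hh
  have hint : ∫⁻ x in U, ENNReal.ofReal (h x) ∂μ ≤ 1 := by
    refine (lintegral_mono fun x => ?_).trans hmG
    change ENNReal.ofReal (((G x).toReal / m) ^ p x) ≤ (G x / ENNReal.ofReal m) ^ p x
    rw [← ENNReal.ofReal_rpow_of_nonneg (by positivity) (hp0 x).le, ENNReal.ofReal_div_of_pos hm0]
    gcongr
    · exact (hp0 x).le
    · exact ENNReal.ofReal_toReal_le
  refine ⟨h, ⟨fun x => by positivity, fun x hx y hy => ?_, fun y ρ L hρ hρδ hball hL hlt => ?_⟩,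
    hint⟩
  · rcases eq_or_ne x y with rfl | hne
    · have : 0 ≤ h x := by positivity
      simp only [sub_self, abs_zero]
      positivity
    obtain ⟨k, hk1, hk2⟩ := exists_dyadic_scale (dist_pos.2 hne)
    have hle := hgrad k x ⟨hx.1, hx.2.1⟩ y ⟨hy.1, hy.2.1⟩ hk1 hk2
    have hcomp : ∀ z ∈ D, g k z ≤ ENNReal.ofReal (G z).toReal := fun z hz => by
      rw [ENNReal.ofReal_toReal hz.2.2.1]
      exact le_iSup (fun k => g k z) k
    have hle2 : |(u x).toReal - (u y).toReal| ≤
        dist x y ^ s x * (G x).toReal + dist x y ^ s y * (G y).toReal := by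
      rw [← ENNReal.ofReal_le_ofReal_iff (by positivity), ENNReal.ofReal_add (by positivity)
        (by positivity), ENNReal.ofReal_mul (by positivity), ENNReal.ofReal_mul (by positivity)]
      refine hle.trans ?_
      gcongr
      exacts [hcomp x hx, hcomp y hy]
    have hroot : ∀ z, h z ^ (1 / p z) = (G z).toReal / m := fun z => by
      rw [hh, ← Real.rpow_mul (by positivity), mul_one_div_cancel (hp0 z).ne', Real.rpow_one]
    rw [hroot, hroot, ← sub_div, abs_div, abs_of_pos hm0, mul_div_assoc', mul_div_assoc',
      ← add_div]
    gcongr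
  · obtain ⟨z, hz, hzB, hzL⟩ := exists_le_of_one_lt_mul_measure (L := L) hnull
      (measurableSet_ball (x := y) (ε := ρ)) hball hint (by
        calc (1 : ℝ≥0∞) < ENNReal.ofReal (L * (b * ρ ^ Q y)) := by
              rw [← ENNReal.ofReal_one]
              exact (ENNReal.ofReal_lt_ofReal_iff (one_pos.trans hlt)).2 hlt
          _ = ENNReal.ofReal L * ENNReal.ofReal (b * ρ ^ Q y) := ENNReal.ofReal_mul hL.le
          _ ≤ _ := by
              gcongr
              exact hst.growth y ρ hρ hρδ)
    exact ⟨z, hz, by rw [dist_comm]; exact hzB, hzL⟩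

end

section

/-! ### The three embeddings -/

lemma ENNReal_le_mul_of_forall_gt {a M : ℝ≥0∞} {S : ℝ} (hS : 0 ≤ S) (hM : M < ∞)
    (h : ∀ m : ℝ, M < ENNReal.ofReal m → a ≤ ENNReal.ofReal (S * m)) :
    a ≤ ENNReal.ofReal S * M := by
  have hlt : ∀ ε : ℝ, 0 < ε → M < ENNReal.ofReal (M.toReal + ε) := fun ε hε => by
    rw [ENNReal.lt_ofReal_iff_toReal_lt hM.ne]
    linarith
  rw [← ENNReal.ofReal_toReal hM.ne, ← ENNReal.ofReal_mul hS]
  have ha : a ≠ ∞ := ne_top_of_le_ne_top ENNReal.ofReal_ne_top (h _ (hlt 1 one_pos))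
  rw [← ENNReal.ofReal_toReal ha]
  refine ENNReal.ofReal_le_ofReal (le_of_forall_pos_le_add fun ε hε => ?_)
  have h1 := ENNReal.toReal_le_of_le_ofReal (by positivity) (h _ (hlt (ε / (S + 1)) (by positivity)))
  refine h1.trans ?_
  rw [mul_add]
  gcongr
  rw [mul_div_assoc', div_le_iff₀ (by positivity)]
  nlinarith

/-- The exponent `γ / gm` is at least `1`, so nothing is lost when `T ≥ 1`. When `T ≤ 1`, the lower
bound `b ≤ T` limits the loss to a power of `b`. -/
lemma mul_le_rpow_rpow {T lo gm γ Γ : ℝ} {b : ℝ} (hb : 0 < b) (hb1 : b ≤ 1) (hT : b ≤ T)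
    (hlo : 0 < lo) (h1 : lo ≤ gm) (h2 : gm ≤ γ) (h3 : γ ≤ Γ) :
    b ^ (Γ / lo) * T ≤ (T ^ (1 / gm)) ^ γ := by
  have hT0 : 0 < T := hb.trans_le hT
  have hgm : 0 < gm := hlo.trans_le h1
  have hγ : 0 < γ := hgm.trans_le h2
  have hR : γ / gm ≤ Γ / lo := by gcongr; exact hγ.le.trans h3
  have hR1 : 1 ≤ γ / gm := by rwa [one_le_div hgm]
  have hbR : b ^ (Γ / lo) ≤ 1 := Real.rpow_le_one hb.le hb1 (by linarith)
  rw [← Real.rpow_mul hT0.le, one_div_mul_eq_div]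
  rcases le_total 1 T with h | h
  · calc b ^ (Γ / lo) * T ≤ T := mul_le_of_le_one_left hT0.le hbR
      _ = T ^ (1 : ℝ) := (Real.rpow_one T).symm
      _ ≤ _ := Real.rpow_le_rpow_of_exponent_le h hR1
  · calc b ^ (Γ / lo) * T ≤ b ^ (Γ / lo) := mul_le_of_le_one_right (by positivity) h
      _ ≤ T ^ (Γ / lo) := Real.rpow_le_rpow hb.le hT (by linarith)
      _ ≤ _ := Real.rpow_le_rpow_of_exponent_ge hT0 h hR

/-! ### Replacing an arbitrary constant by the mean value -/

section Average

variable {Y : Type*} [MeasurableSpace Y] {ν : Measure Y} [IsFiniteMeasure ν]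

lemma integrable_of_lintegral_exp {f : Y → ℝ} (hf : AEMeasurable f ν) {a c : ℝ} (hc : 0 < c)
    (h : ∫⁻ x, ENNReal.ofReal (Real.exp (c * |f x - a|)) ∂ν < ∞) :
    Integrable f ν ∧ Integrable (fun x => Real.exp (c * |f x - a|)) ν := by
  have hm : AEMeasurable (fun x => Real.exp (c * |f x - a|)) ν :=
    Real.measurable_exp.comp_aemeasurable
      ((measurable_norm.comp_aemeasurable (hf.sub_const a)).const_mul c)
  have hexp : Integrable (fun x => Real.exp (c * |f x - a|)) ν := by
    refine ⟨hm.aestronglyMeasurable, ?_⟩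
    rw [hasFiniteIntegral_iff_ofReal (.of_forall fun x => (Real.exp_pos _).le)]
    exact h
  refine ⟨?_, hexp⟩
  have h1 : Integrable (fun x => f x - a) ν := by
    refine (hexp.const_mul c⁻¹).mono' (hf.sub_const a).aestronglyMeasurable
      (.of_forall fun x => ?_)
    rw [Real.norm_eq_abs, inv_mul_eq_div, le_div_iff₀ hc]
    linarith [Real.add_one_le_exp (c * |f x - a|)]
  exact (h1.add (integrable_const a)).congr (.of_forall fun x => sub_add_cancel _ _)

variable [NeZero ν]

lemma abs_sub_average_le {f : Y → ℝ} (hf : Integrable f ν) {y K : ℝ}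
    (h : ∀ᵐ x ∂ν, |y - f x| ≤ K) : |y - ⨍ x, f x ∂ν| ≤ K := by
  have hmem : ⨍ x, f x ∂ν ∈ Icc (y - K) (y + K) := by
    refine (convex_Icc _ _).average_mem isClosed_Icc ?_ hf
    filter_upwards [h] with x hx
    rw [abs_le] at hx
    constructor <;> linarith
  rw [abs_le]
  constructor <;> linarith [hmem.1, hmem.2]

/-- Exponential integrability around some constant gives exponential integrability around the
mean value. -/
lemma lintegral_exp_average_le {f : Y → ℝ} (hf : AEMeasurable f ν) {a c K : ℝ} (hc : 0 < c)
    (hK : 0 < K)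
    (h : ∫⁻ x, ENNReal.ofReal (Real.exp (c * |f x - a|)) ∂ν ≤ ENNReal.ofReal K * ν univ) :
    Integrable f ν ∧ ∫⁻ x, ENNReal.ofReal (Real.exp (c * |f x - ⨍ y, f y ∂ν|)) ∂ν ≤
      ENNReal.ofReal (K * Real.exp K) * ν univ := by
  obtain ⟨hint, hexp⟩ := integrable_of_lintegral_exp hf hc
    (h.trans_lt (ENNReal.mul_lt_top ENNReal.ofReal_lt_top (measure_lt_top ν univ)))
  have hν : 0 < ν.real univ := by
    simpa [Measure.real, ENNReal.toReal_pos_iff] using NeZero.ne ν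
  -- From `t ≤ exp t`, the hypothesis bounds the mean of `c * |f - a|` by `K`; recentring then costs
  -- only a factor `exp K`.
  have hmean : c * |a - ⨍ y, f y ∂ν| ≤ K := by
    have h1 : ∫ x, Real.exp (c * |f x - a|) ∂ν ≤ K * ν.real univ := by
      rw [integral_eq_lintegral_of_nonneg_ae (.of_forall fun x => (Real.exp_pos _).le)
        hexp.aestronglyMeasurable]
      refine (ENNReal.toReal_mono (by finiteness) h).trans_eq ?_
      rw [ENNReal.toReal_mul, ENNReal.toReal_ofReal hK.le]
      rfl
    have h2 : a - ⨍ y, f y ∂ν = (ν.real univ)⁻¹ * ∫ y, (a - f y) ∂ν := by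
      rw [integral_sub (integrable_const a) hint, average_eq, integral_const, smul_eq_mul,
        smul_eq_mul]
      field_simp
    have h3 : c * |∫ y, (a - f y) ∂ν| ≤ ∫ x, Real.exp (c * |f x - a|) ∂ν := by
      calc c * |∫ y, (a - f y) ∂ν| ≤ c * ∫ y, |a - f y| ∂ν := by
            gcongr
            exact abs_integral_le_integral_abs
        _ = ∫ y, c * |a - f y| ∂ν := (integral_const_mul _ _).symm
        _ ≤ _ := by
            refine integral_mono (((integrable_const a).sub hint).abs.const_mul c) hexp
              fun x => ?_
            simp only
            rw [abs_sub_comm]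
            linarith [Real.add_one_le_exp (c * |f x - a|)]
    rw [h2, abs_mul, abs_of_pos (inv_pos.2 hν), mul_left_comm, inv_mul_le_iff₀ hν]
    linarith
  refine ⟨hint, ?_⟩
  calc ∫⁻ x, ENNReal.ofReal (Real.exp (c * |f x - ⨍ y, f y ∂ν|)) ∂ν
      ≤ ∫⁻ x, ENNReal.ofReal (Real.exp K) * ENNReal.ofReal (Real.exp (c * |f x - a|)) ∂ν := by
        refine lintegral_mono fun x => ?_
        rw [← ENNReal.ofReal_mul (Real.exp_pos _).le, ← Real.exp_add]
        refine ENNReal.ofReal_le_ofReal (Real.exp_le_exp.2 ?_)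
        have := mul_le_mul_of_nonneg_left (abs_sub_le (f x) a (⨍ y, f y ∂ν)) hc.le
        linarith
    _ = ENNReal.ofReal (Real.exp K) * ∫⁻ x, ENNReal.ofReal (Real.exp (c * |f x - a|)) ∂ν :=
        lintegral_const_mul' _ _ ENNReal.ofReal_ne_top
    _ ≤ ENNReal.ofReal (Real.exp K) * (ENNReal.ofReal K * ν univ) := by gcongr
    _ = _ := by
        rw [← mul_assoc, ← ENNReal.ofReal_mul (Real.exp_pos _).le, mul_comm K]

end Average

lemma ae_restrict_mem_of_measure_diff {Y : Type*} [MeasurableSpace Y] {μ : Measure Y} {U D B : Set Y} (hB : MeasurableSet B)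
    (hBU : B ⊆ U) (hD : μ (U \ D) = 0) : ∀ᵐ x ∂μ.restrict B, x ∈ D ∧ x ∈ B := by
  rw [ae_restrict_iff' hB]
  filter_upwards [measure_eq_zero_iff_ae_notMem.1 hD] with x hx hxB
  exact ⟨by_contra fun h => hx ⟨hBU hxB, h⟩, hxB⟩

variable {X : Type*} [MetricSpace X] [MeasurableSpace X] {Q p s : X → ℝ} {lo hi b δ σ : ℝ}

lemma IsMetricMeasure.restrict_ball {μ : Measure X} (hμ : IsMetricMeasure μ) (x : X) {r : ℝ}
    (hr : 0 < r) : IsFiniteMeasure (μ.restrict (ball x r)) ∧ NeZero (μ.restrict (ball x r)) :=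
  ⟨⟨by simpa using (hμ x r hr).2⟩, ⟨fun h => by
    have := Measure.restrict_apply_self μ (ball x r)
    rw [h] at this
    exact (hμ x r hr).1.ne this⟩⟩

lemma measure_ball_eq_ofReal {μ : Measure X} (hst : Standing μ Q p s b δ)
    {x₀ : X} {r₀ : ℝ} (hr : 0 < r₀) (hrδ : r₀ ≤ δ) :
    μ (ball x₀ r₀) = ENNReal.ofReal ((μ (ball x₀ r₀)).toReal / r₀ ^ Q x₀ * r₀ ^ Q x₀) ∧
      b ≤ (μ (ball x₀ r₀)).toReal / r₀ ^ Q x₀ := by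
  have hfin := (hst.metricMeasure x₀ r₀ hr).2.ne
  have hpos : 0 < r₀ ^ Q x₀ := by positivity
  refine ⟨by rw [div_mul_cancel₀ _ hpos.ne', ENNReal.ofReal_toReal hfin], ?_⟩
  rw [le_div_iff₀ hpos, ← ENNReal.ofReal_le_iff_le_toReal hfin]
  exact hst.growth x₀ r₀ hr hrδ

lemma LocalData.aemeasurable_toReal {A : Scale} {μ : Measure X} {x₀ : X} {r₀ : ℝ}
    {q : X → ℝ≥0∞} {u : X → EReal} {g : ℤ → X → ℝ≥0∞} (hσ : 1 < σ)
    (hl : LocalData A μ s p δ σ x₀ r₀ q u g) :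
    AEMeasurable (fun x => (u x).toReal) (μ.restrict (ball x₀ r₀)) := by
  have hBU : ball x₀ r₀ ⊆ ball x₀ (σ * r₀) :=
    ball_subset_ball (by nlinarith [hl.radius_pos])
  exact measurable_ereal_toReal.comp_aemeasurable
    (hl.mem_space.aemeasurable.mono_measure (Measure.restrict_mono_set μ hBU))

variable [BorelSpace X]

theorem Exponents.sobolev (hE : Exponents Q p s lo hi) (hb : 0 < b) (hb1 : b ≤ 1) (hσ : 1 < σ)
    (A : Scale) {c : ℝ} (hc : 0 < c) (hQ : ∀ x, c ≤ Q x - s x * p x) :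
    ∃ C : ℝ, 0 < C ∧ ∀ μ : Measure X, Standing μ Q p s b δ →
      ∀ (x₀ : X) (r₀ : ℝ) (q : X → ℝ≥0∞) (u : X → EReal) (g : ℤ → X → ℝ≥0∞),
      LocalData A μ s p δ σ x₀ r₀ q u g →
      ∀ γ : X → ℝ, (∀ x, γ x = Q x * p x / (Q x - s x * p x)) →
      (⨅ a : ℝ, luxNorm μ (ball x₀ r₀) γ (fun x => ENNReal.ofReal |(u x).toReal - a|)) ≤
        ENNReal.ofReal (C * ((μ (ball x₀ r₀)).toReal / r₀ ^ Q x₀) ^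
          (1 / essInf γ (μ.restrict (ball x₀ r₀)))) * mixedNorm A μ (ball x₀ (σ * r₀)) p q g := by
  obtain ⟨C, hC, hpt⟩ := hE.sobolev_pointwise (δ := δ) hb hσ hc hQ
  have hlo := hE.lo_pos
  set Γ := hi * hi / c with hΓ
  set R := Γ / lo with hR
  set V := C * (1 + 1 / b) / b ^ R with hV
  have hbinv : 0 < 1 / b := by positivity
  have hV0 : 0 < V := by positivity
  rcases isEmpty_or_nonempty X with hX | ⟨⟨x₁⟩⟩
  · exact ⟨1, one_pos, fun μ _ x => hX.elim x⟩
  have hhi := hE.hi_pos x₁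
  have hR0 : 0 < R := by positivity
  have hV1 : 1 ≤ V := by
    rw [hV, le_div_iff₀ (by positivity), one_mul]
    have : b ^ R ≤ 1 := Real.rpow_le_one hb.le hb1 hR0.le
    nlinarith
  refine ⟨V ^ (1 / lo), by positivity, fun μ hst x₀ r₀ q u g hl γ hγ => ?_⟩
  have hr := hl.radius_pos
  have hrδ := le_of_le_div hσ hr hl.radius_le
  obtain ⟨hfin, D, hDU, hD, huD, hchain⟩ := hl.exists_chainData hst hE
  obtain ⟨hμB, hbT⟩ := measure_ball_eq_ofReal (x₀ := x₀) hst hr hrδ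
  set T := (μ (ball x₀ r₀)).toReal / r₀ ^ Q x₀ with hT
  have hT0 : 0 < T := hb.trans_le hbT
  obtain ⟨hfinite, hne⟩ := hst.metricMeasure.restrict_ball x₀ hr
  have hBU : ball x₀ r₀ ⊆ ball x₀ (σ * r₀) := ball_subset_ball (by nlinarith)
  have hγlo : ∀ x, lo ≤ γ x := fun x => by
    have h1 := hc.trans_le (hQ x)
    have h2 := mul_pos (hE.s_pos x) (hE.p_pos x)
    have h3 := hE.p_pos x
    rw [hγ, le_div_iff₀ h1]
    nlinarith [(hE.p_mem x).1, hE.Q_pos x]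
  have hγhi : ∀ x, γ x ≤ Γ := fun x => by
    rw [hγ, hΓ]
    have h1 := hE.Q_pos x
    have h2 := hE.p_pos x
    gcongr
    exacts [(hE.Q_mem x).2, (hE.p_mem x).2, hQ x]
  set gm := essInf γ (μ.restrict (ball x₀ r₀)) with hgm
  have hbdd : Filter.IsBoundedUnder (fun x1 x2 => x1 ≥ x2) (ae (μ.restrict (ball x₀ r₀))) γ :=
    Filter.isBoundedUnder_of ⟨lo, hγlo⟩
  have hcob : Filter.IsCoboundedUnder (fun x1 x2 => x1 ≥ x2) (ae (μ.restrict (ball x₀ r₀))) γ :=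
    (Filter.isBoundedUnder_of (r := fun x1 x2 => x1 ≤ x2) ⟨Γ, hγhi⟩).isCoboundedUnder_ge
  have hgmlo : lo ≤ gm := le_essInf_of_ae_le lo (.of_forall hγlo) hcob
  have hgmae := ae_essInf_le hbdd
  refine ENNReal_le_mul_of_forall_gt (by positivity) hfin fun m hm => ?_
  have hm0 : 0 < m := ENNReal.ofReal_pos.1 ((zero_le).trans_lt hm)
  obtain ⟨h, hd, hint⟩ := hchain m hm
  obtain ⟨a, ha⟩ := hpt D _ h x₀ r₀ hr hl.radius_le hd
  set S := V ^ (1 / lo) * T ^ (1 / gm) with hS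
  have hS0 : 0 < S := by positivity
  -- The chain data belong to `u / m`, so its constant `a` is scaled back by `m`.
  refine iInf_le_of_le (m * a) (sInf_le ⟨by simp; positivity, ENNReal.ofReal_lt_top, ?_⟩)
  set W := C / V / (b ^ R * T) with hW
  have hW0 : 0 < W := by positivity
  have hpoint : ∀ᵐ x ∂μ.restrict (ball x₀ r₀),
      (ENNReal.ofReal |(u x).toReal - m * a| / ENNReal.ofReal (S * m)) ^ γ x ≤
        ENNReal.ofReal W * (ENNReal.ofReal (r₀ ^ (-Q x₀)) + ENNReal.ofReal (h x)) := by
    filter_upwards [ae_restrict_mem_of_measure_diff measurableSet_ball hBU hD, hgmae]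
      with x ⟨hxD, hxB⟩ hxγ
    have hγ0 : 0 < γ x := hlo.trans_le (hγlo x)
    have hax := ha x hxD hxB
    rw [← hγ] at hax
    have hh := hd.nonneg x
    rw [← ENNReal.ofReal_div_of_pos (by positivity), ENNReal.ofReal_rpow_of_nonneg (by positivity)
      hγ0.le, ← ENNReal.ofReal_add (by positivity) hh, ← ENNReal.ofReal_mul hW0.le]
    refine ENNReal.ofReal_le_ofReal ?_
    have e1 : |(u x).toReal - m * a| / (S * m) = |(u x).toReal / m - a| / S := by
      have : (u x).toReal - m * a = m * ((u x).toReal / m - a) := by field_simp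
      rw [this, abs_mul, abs_of_pos hm0]
      field_simp
    have e2 : V * (b ^ R * T) ≤ S ^ γ x := by
      rw [hS, Real.mul_rpow (by positivity) (by positivity)]
      gcongr
      · rw [← Real.rpow_mul hV0.le, one_div_mul_eq_div]
        conv_lhs => rw [← Real.rpow_one V]
        exact Real.rpow_le_rpow_of_exponent_le hV1 (by rw [one_le_div hlo]; exact hγlo x)
      · exact mul_le_rpow_rpow hb hb1 hbT hlo hgmlo hxγ (hγhi x)
    rw [e1, Real.div_rpow (abs_nonneg _) hS0.le, div_le_iff₀ (by positivity)]
    calc |(u x).toReal / m - a| ^ γ x ≤ C * (r₀ ^ (-Q x₀) + h x) := hax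
      _ = W * (r₀ ^ (-Q x₀) + h x) * (V * (b ^ R * T)) := by rw [hW]; field_simp
      _ ≤ _ := by gcongr
  calc modular μ (ball x₀ r₀) γ
        (fun x => ENNReal.ofReal |(u x).toReal - m * a| / ENNReal.ofReal (S * m))
      ≤ ∫⁻ x in ball x₀ r₀, ENNReal.ofReal W *
          (ENNReal.ofReal (r₀ ^ (-Q x₀)) + ENNReal.ofReal (h x)) ∂μ := lintegral_mono_ae hpoint
    _ = ENNReal.ofReal W * (ENNReal.ofReal (r₀ ^ (-Q x₀)) * μ (ball x₀ r₀) +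
          ∫⁻ x in ball x₀ r₀, ENNReal.ofReal (h x) ∂μ) := by
        rw [lintegral_const_mul' _ _ ENNReal.ofReal_ne_top,
          lintegral_add_left measurable_const, setLIntegral_const]
    _ ≤ ENNReal.ofReal W * (ENNReal.ofReal T + ENNReal.ofReal 1) := by
        gcongr
        · rw [hμB, ← ENNReal.ofReal_mul (by positivity)]
          refine ENNReal.ofReal_le_ofReal (le_of_eq ?_)
          rw [mul_left_comm, ← Real.rpow_add hr]
          simp
        · rw [ENNReal.ofReal_one]
          exact (lintegral_mono_set hBU).trans hint
    _ = ENNReal.ofReal (W * (T + 1)) := by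
        rw [← ENNReal.ofReal_add hT0.le zero_le_one, ← ENNReal.ofReal_mul hW0.le]
    _ ≤ 1 := by
        rw [ENNReal.ofReal_le_one]
        have e : W = ((1 + 1 / b) * T)⁻¹ := by
          rw [hW, hV]; field_simp
        rw [e, inv_mul_le_iff₀ (by positivity), mul_one, add_mul, one_mul]
        have : 1 ≤ 1 / b * T := by rwa [one_div, ← div_eq_inv_mul, one_le_div hb]
        linarith

theorem Exponents.moserTrudinger (hE : Exponents Q p s lo hi) (hb : 0 < b) (hσ : 1 < σ)
    (A : Scale) (hQ : ∀ x, s x * p x = Q x) :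
    ∃ C₁ C₂ : ℝ, 0 < C₁ ∧ 0 < C₂ ∧ ∀ μ : Measure X, Standing μ Q p s b δ →
      ∀ (x₀ : X) (r₀ : ℝ) (q : X → ℝ≥0∞) (u : X → EReal) (g : ℤ → X → ℝ≥0∞),
      LocalData A μ s p δ σ x₀ r₀ q u g →
      0 < mixedNorm A μ (ball x₀ (σ * r₀)) p q g →
      IntegrableOn (fun x => (u x).toReal) (ball x₀ r₀) μ ∧
      (⨍⁻ x in ball x₀ r₀, ENNReal.ofReal (Real.exp
        (C₁ * (|(u x).toReal - ⨍ y in ball x₀ r₀, (u y).toReal ∂μ| /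
          (mixedNorm A μ (ball x₀ (σ * r₀)) p q g).toReal))) ∂μ) ≤ ENNReal.ofReal C₂ := by
  obtain ⟨c, C, hc, hC, hpt⟩ := hE.moserTrudinger_pointwise (δ := δ) hb hσ hQ
  set K := C * (1 + 1 / b) with hK
  have hK0 : 0 < K := by positivity
  refine ⟨c / 2, K * Real.exp K, by positivity, by positivity,
    fun μ hst x₀ r₀ q u g hl hpos => ?_⟩
  have hr := hl.radius_pos
  have hrδ := le_of_le_div hσ hr hl.radius_le
  obtain ⟨hfin, D, hDU, hD, huD, hchain⟩ := hl.exists_chainData hst hE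
  obtain ⟨hμB, hbT⟩ := measure_ball_eq_ofReal (x₀ := x₀) hst hr hrδ
  obtain ⟨hfinite, hne⟩ := hst.metricMeasure.restrict_ball x₀ hr
  have hBU : ball x₀ r₀ ⊆ ball x₀ (σ * r₀) := ball_subset_ball (by nlinarith)
  set M := (mixedNorm A μ (ball x₀ (σ * r₀)) p q g).toReal with hM
  have hM0 : 0 < M := ENNReal.toReal_pos hpos.ne' hfin.ne
  -- As `M > 0`, the value `2 * M` is strictly above the norm; the factor `2` reappears in the
  -- constant `c / 2`.
  obtain ⟨h, hd, hint⟩ := hchain (2 * M) (by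
    rw [ENNReal.lt_ofReal_iff_toReal_lt hfin.ne]
    linarith)
  obtain ⟨a, ha⟩ := hpt D _ h x₀ r₀ hr hl.radius_le hd
  have hmeas := hl.aemeasurable_toReal hσ
  have hQpos : 0 < r₀ ^ Q x₀ := by positivity
  have hexp : ∫⁻ x in ball x₀ r₀,
      ENNReal.ofReal (Real.exp (c * |(u x).toReal / (2 * M) - a|)) ∂μ ≤
      ENNReal.ofReal K * μ.restrict (ball x₀ r₀) univ := by
    calc _ ≤ ∫⁻ x in ball x₀ r₀, ENNReal.ofReal C *
          (ENNReal.ofReal 1 + ENNReal.ofReal (h x) * ENNReal.ofReal (r₀ ^ Q x₀)) ∂μ := by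
          refine lintegral_mono_ae ?_
          filter_upwards [ae_restrict_mem_of_measure_diff measurableSet_ball hBU hD]
            with x ⟨hxD, hxB⟩
          have hh := hd.nonneg x
          rw [← ENNReal.ofReal_mul hh, ← ENNReal.ofReal_add zero_le_one (by positivity),
            ← ENNReal.ofReal_mul hC.le]
          exact ENNReal.ofReal_le_ofReal (ha x hxD hxB)
      _ = ENNReal.ofReal C * (ENNReal.ofReal 1 * μ (ball x₀ r₀) +
          (∫⁻ x in ball x₀ r₀, ENNReal.ofReal (h x) ∂μ) * ENNReal.ofReal (r₀ ^ Q x₀)) := by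
          rw [lintegral_const_mul' _ _ ENNReal.ofReal_ne_top,
            lintegral_add_left measurable_const, setLIntegral_const,
            lintegral_mul_const' _ _ ENNReal.ofReal_ne_top]
      _ ≤ ENNReal.ofReal C * (ENNReal.ofReal 1 * μ (ball x₀ r₀) +
          1 * (ENNReal.ofReal (1 / b) * μ (ball x₀ r₀))) := by
          gcongr
          · exact (lintegral_mono_set hBU).trans hint
          · rw [hμB, ← ENNReal.ofReal_mul (by positivity)]
            refine ENNReal.ofReal_le_ofReal ?_
            rw [← mul_assoc]
            refine le_mul_of_one_le_left hQpos.le ?_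
            rwa [one_div, ← div_eq_inv_mul, one_le_div hb]
      _ = _ := by
          rw [one_mul, ← add_mul, ← ENNReal.ofReal_add zero_le_one (by positivity), ← mul_assoc,
            ← ENNReal.ofReal_mul hC.le, Measure.restrict_apply_univ]
  obtain ⟨hint', hav⟩ := lintegral_exp_average_le (hmeas.div_const (2 * M)) hc hK0 hexp
  have hu : IntegrableOn (fun x => (u x).toReal) (ball x₀ r₀) μ := by
    have := Integrable.mul_const hint' (2 * M)
    simp only [div_mul_cancel₀ _ (by positivity : 2 * M ≠ 0)] at this
    exact this
  refine ⟨hu, ?_⟩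
  rw [setLAverage_eq]
  refine ENNReal.div_le_of_le_mul ?_
  rw [Measure.restrict_apply_univ] at hav
  refine le_of_eq_of_le (lintegral_congr fun x => ?_) hav
  have e : ⨍ y in ball x₀ r₀, (u y).toReal / (2 * M) ∂μ =
      (⨍ y in ball x₀ r₀, (u y).toReal ∂μ) / (2 * M) := by
    rw [average_eq, average_eq, integral_div, smul_eq_mul, smul_eq_mul, mul_div_assoc]
  rw [e, ← sub_div, abs_div, abs_of_pos (show 0 < 2 * M by positivity)]
  congr 2
  field_simp

end

/-! ### Continuous representatives and the Morrey case -/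

section

open Filter Topology in
/-- A function that is Hölder continuous with a variable exponent extends to the closure. -/
lemma exists_holder_extension {X : Type*} [MetricSpace X] {F B : Set X} (hFB : B ⊆ closure F)
    {α : X → ℝ} (hα : Continuous α) (hα0 : ∀ x, 0 < α x) {f : X → ℝ} {K : ℝ}
    (hf : ∀ x ∈ F, ∀ y ∈ F, |f x - f y| ≤ K * dist x y ^ α x) :
    ∃ v : X → ℝ, ContinuousOn v B ∧ (∀ x ∈ F, v x = f x) ∧
      ∀ x ∈ B, ∀ y ∈ B, |v x - v y| ≤ K * dist x y ^ α x := by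
  have hφ : Continuous fun z : X × X => K * dist z.1 z.2 ^ α z.1 :=
    continuous_const.mul ((continuous_fst.dist continuous_snd).rpow (hα.comp continuous_fst)
      fun z => Or.inr (hα0 z.1))
  have hlim : ∀ x y : X, Tendsto (fun z : X × X => K * dist z.1 z.2 ^ α z.1)
      (𝓝[F] x ×ˢ 𝓝[F] y) (𝓝 (K * dist x y ^ α x)) := fun x y => by
    refine (hφ.tendsto (x, y)).mono_left ?_
    rw [nhds_prod_eq]
    exact prod_mono nhdsWithin_le_nhds nhdsWithin_le_nhds
  have hmem : ∀ x y : X, ∀ᶠ z in 𝓝[F] x ×ˢ 𝓝[F] y, |f z.1 - f z.2| ≤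
      K * dist z.1 z.2 ^ α z.1 := fun x y => by
    filter_upwards [prod_mem_prod self_mem_nhdsWithin self_mem_nhdsWithin] with z hz
    exact hf z.1 hz.1 z.2 hz.2
  have hzero : ∀ x : X, K * dist x x ^ α x = 0 := fun x => by
    rw [dist_self, Real.zero_rpow (hα0 x).ne', mul_zero]
  have hex : ∀ x ∈ closure F, ∃ y, Tendsto f (𝓝[F] x) (𝓝 y) := by
    intro x hx
    have : (𝓝[F] x).NeBot := mem_closure_iff_nhdsWithin_neBot.1 hx
    refine cauchy_map_iff_exists_tendsto.1 ?_
    rw [cauchy_map_iff]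
    -- The Hölder bound tends to `0` on the diagonal because the exponent is positive there, so `f`
    -- is Cauchy along `F` at each point of the closure.
    refine ⟨this, tendsto_uniformity_iff_dist_tendsto_zero.2 ?_⟩
    refine squeeze_zero' (.of_forall fun z => dist_nonneg) (hmem x x) ?_
    simpa only [hzero] using hlim x x
  have hv : ∀ x ∈ closure F, Tendsto f (𝓝[F] x) (𝓝 (extendFrom F f x)) :=
    fun x hx => tendsto_extendFrom (hex x hx)
  refine ⟨extendFrom F f, continuousOn_extendFrom hFB fun x hx => hex x (hFB hx), ?_, ?_⟩
  · intro x hx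
    refine extendFrom_eq (subset_closure hx) ?_
    rw [tendsto_iff_dist_tendsto_zero]
    have h1 : Tendsto (fun y => K * dist y x ^ α y) (𝓝[F] x) (𝓝 (K * dist x x ^ α x)) := by
      have : Continuous fun y => K * dist y x ^ α y :=
        hφ.comp (continuous_id.prodMk continuous_const)
      exact (this.tendsto x).mono_left nhdsWithin_le_nhds
    rw [hzero] at h1
    refine squeeze_zero' (.of_forall fun z => dist_nonneg) ?_ h1
    filter_upwards [self_mem_nhdsWithin] with y hy
    exact hf y hy x hx
  · intro x hx y hy
    have h1 : (𝓝[F] x).NeBot := mem_closure_iff_nhdsWithin_neBot.1 (hFB hx)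
    have h2 : (𝓝[F] y).NeBot := mem_closure_iff_nhdsWithin_neBot.1 (hFB hy)
    refine le_of_tendsto_of_tendsto ?_ (hlim x y) (hmem x y)
    exact (((hv x (hFB hx)).comp tendsto_fst).sub ((hv y (hFB hy)).comp tendsto_snd)).abs

open Filter Topology in
lemma le_mul_of_forall_gt {a S M : ℝ} (h : ∀ m, M < m → a ≤ S * m) : a ≤ S * M := by
  have h1 : Tendsto (fun m => S * m) (𝓝[>] M) (𝓝 (S * M)) :=
    ((continuous_const.mul continuous_id).tendsto M).mono_left nhdsWithin_le_nhds
  refine ge_of_tendsto h1 ?_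
  filter_upwards [self_mem_nhdsWithin] with m hm
  exact h m hm

variable {X : Type*} [MetricSpace X] [MeasurableSpace X] {Q p s : X → ℝ} {lo hi b δ σ : ℝ}

/-- A full-measure subset is dense, since a ball missing it would be null. -/
lemma IsMetricMeasure.ball_subset_closure {μ : Measure X} (hμ : IsMetricMeasure μ) {x₀ : X}
    {r : ℝ} {U D : Set X} (hU : ball x₀ r ⊆ U) (hD : μ (U \ D) = 0) :
    ball x₀ r ⊆ closure (D ∩ ball x₀ r) := by
  intro x hx
  rw [Metric.mem_closure_iff]
  intro ε hε
  obtain ⟨t, ht, htB⟩ := Metric.isOpen_iff.1 ((isOpen_ball (x := x) (ε := ε)).inter (isOpen_ball (x := x₀) (ε := r)))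
    x ⟨mem_ball_self hε, hx⟩
  by_contra! hcon
  have hsub : ball x t ⊆ U \ D := fun y hy => ⟨hU (htB hy).2, fun hyD =>
    absurd (mem_ball'.1 (htB hy).1) (hcon y ⟨hyD, (htB hy).2⟩).not_gt⟩
  exact (hμ x t ht).1.ne' (measure_mono_null hsub hD)

/-- The constant in the Hölder estimate is at least `C`. -/
lemma le_holder_const {a C δ σ r : ℝ} (ha : 0 ≤ a) (hC : 0 ≤ C) (hσ : 1 < σ) (hr : 0 < r)
    (hrδ : r ≤ δ) : C ≤ 2 ^ (a + 1) * C * (σ * δ / ((σ - 1) * r)) ^ a := by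
  have h1 : (1 : ℝ) ≤ 2 ^ (a + 1) := Real.one_le_rpow one_le_two (by linarith)
  have h2 : 1 ≤ (σ * δ / ((σ - 1) * r)) ^ a := by
    refine Real.one_le_rpow ?_ ha
    rw [one_le_div (mul_pos (by linarith) hr)]
    nlinarith
  calc C ≤ 2 ^ (a + 1) * C := le_mul_of_one_le_left hC h1
    _ ≤ _ := le_mul_of_one_le_right (by positivity) h2

variable [BorelSpace X]

theorem Exponents.morrey (hE : Exponents Q p s lo hi) (hb : 0 < b) (hσ : 1 < σ)
    (A : Scale) {c : ℝ} (hc : 0 < c) (hα : ∀ x, c ≤ s x - Q x / p x) :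
    ∃ C : ℝ, 0 < C ∧ ∀ μ : Measure X, Standing μ Q p s b δ →
      ∀ (x₀ : X) (r₀ : ℝ) (q : X → ℝ≥0∞) (u : X → EReal) (g : ℤ → X → ℝ≥0∞),
      LocalData A μ s p δ σ x₀ r₀ q u g →
      ∀ α : X → ℝ, (∀ x, α x = s x - Q x / p x) →
      IntegrableOn (fun x => (u x).toReal) (ball x₀ r₀) μ ∧
      eLpNorm (fun x => (u x).toReal - ⨍ y in ball x₀ r₀, (u y).toReal ∂μ) ∞
          (μ.restrict (ball x₀ r₀)) ≤
        ENNReal.ofReal (C * r₀ ^ α x₀) * mixedNorm A μ (ball x₀ (σ * r₀)) p q g ∧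
      ∃ v : X → ℝ, ContinuousOn v (ball x₀ r₀) ∧
        (∀ᵐ x ∂(μ.restrict (ball x₀ r₀)), u x = (v x : EReal)) ∧
        ∀ x ∈ ball x₀ r₀, ∀ y ∈ ball x₀ r₀,
          ENNReal.ofReal |v x - v y| ≤
            ENNReal.ofReal ((2 ^ (essSup α μ + 1) * C *
                (σ * δ / ((σ - 1) * r₀)) ^ essSup α μ) * dist x y ^ α x) *
              mixedNorm A μ (ball x₀ (σ * r₀)) p q g := by
  rcases isEmpty_or_nonempty X with hX | ⟨⟨x₁⟩⟩
  · exact ⟨1, one_pos, fun μ _ x => hX.elim x⟩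
  have hhi := hE.hi_pos x₁
  obtain ⟨C₁, hC₁, hpt⟩ := hE.morrey_pointwise (δ := δ) hb hσ hc hα
  obtain ⟨C₂, hC₂, hLH⟩ := hE.logHolder_smoothness.rpow_le (R := δ) one_pos
  have h2hi : (1 : ℝ) ≤ 2 ^ hi := Real.one_le_rpow one_le_two hhi.le
  have hC₁C : C₁ ≤ C₁ * (2 ^ hi * C₂) := le_mul_of_one_le_right hC₁.le (by nlinarith)
  -- In the oscillation bound, `2 ^ hi` comes from `dist x y ≤ 2 * r₀`, and `C₂` from moving the
  -- exponent of `r₀` from `x` to `x₀`.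
  set C := C₁ * (2 ^ hi * C₂) with hC
  have hC0 : 0 < C := by positivity
  refine ⟨C, hC0, fun μ hst x₀ r₀ q u g hl α hαdef => ?_⟩
  obtain rfl : α = fun x => s x - Q x / p x := funext hαdef
  have hr := hl.radius_pos
  have hrδ := le_of_le_div hσ hr hl.radius_le
  obtain ⟨hfin, D, hDU, hD, huD, hchain⟩ := hl.exists_chainData hst hE
  obtain ⟨hfinite, hne⟩ := hst.metricMeasure.restrict_ball x₀ hr
  have hBU : ball x₀ r₀ ⊆ ball x₀ (σ * r₀) := ball_subset_ball (by nlinarith)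
  have haeF := ae_restrict_mem_of_measure_diff (μ := μ) measurableSet_ball hBU hD
  set M := (mixedNorm A μ (ball x₀ (σ * r₀)) p q g).toReal with hM
  have hM0 : 0 ≤ M := ENNReal.toReal_nonneg
  have hMeq : mixedNorm A μ (ball x₀ (σ * r₀)) p q g = ENNReal.ofReal M :=
    (ENNReal.ofReal_toReal hfin.ne).symm
  rw [hMeq]
  have hαpos : ∀ x, 0 < s x - Q x / p x := fun x => hc.trans_le (hα x)
  have hF : ∀ x ∈ D ∩ ball x₀ r₀, ∀ y ∈ D ∩ ball x₀ r₀, |(u x).toReal - (u y).toReal| ≤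
      C₁ * M * dist x y ^ (s x - Q x / p x) := by
    intro x hx y hy
    have h1 : |(u x).toReal - (u y).toReal| ≤ C₁ * dist x y ^ (s x - Q x / p x) * M := by
      refine le_mul_of_forall_gt fun m hm => ?_
      have hm0 : 0 < m := hM0.trans_lt hm
      obtain ⟨h, hd, -⟩ := hchain m (by rwa [ENNReal.lt_ofReal_iff_toReal_lt hfin.ne])
      have := hpt D _ h x₀ r₀ hr hl.radius_le hd x hx.1 hx.2 y hy.1 hy.2
      rwa [← sub_div, abs_div, abs_of_pos hm0, div_le_iff₀ hm0] at this
    linarith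
  have hosc : ∀ x ∈ D ∩ ball x₀ r₀, ∀ y ∈ D ∩ ball x₀ r₀, |(u x).toReal - (u y).toReal| ≤
      C * r₀ ^ (s x₀ - Q x₀ / p x₀) * M := by
    intro x hx y hy
    have hxy : dist x y ≤ 2 * r₀ := by
      have := dist_triangle_right x y x₀
      linarith [mem_ball.1 hx.2, mem_ball.1 hy.2]
    have h1 := hLH x x₀ r₀ hr hrδ (by rw [one_mul]; exact (mem_ball.1 hx.2).le)
    have h2 : dist x y ^ (s x - Q x / p x) ≤ 2 ^ hi * (C₂ * r₀ ^ (s x₀ - Q x₀ / p x₀)) := by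
      calc dist x y ^ (s x - Q x / p x) ≤ (2 * r₀) ^ (s x - Q x / p x) :=
            Real.rpow_le_rpow dist_nonneg hxy (hαpos x).le
        _ = 2 ^ (s x - Q x / p x) * r₀ ^ (s x - Q x / p x) :=
            Real.mul_rpow zero_le_two hr.le
        _ ≤ _ := mul_le_mul
            (Real.rpow_le_rpow_of_exponent_le one_le_two (hE.smoothness_le x)) h1
            (by positivity) (by positivity)
    calc |(u x).toReal - (u y).toReal| ≤ C₁ * M * dist x y ^ (s x - Q x / p x) := hF x hx y hy
      _ ≤ C₁ * M * (2 ^ hi * (C₂ * r₀ ^ (s x₀ - Q x₀ / p x₀))) :=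
          mul_le_mul_of_nonneg_left h2 (by positivity)
      _ = _ := by rw [hC]; ring
  have hint : IntegrableOn (fun x => (u x).toReal) (ball x₀ r₀) μ := by
    obtain ⟨y, hy⟩ := haeF.exists
    refine Integrable.of_bound (hl.aemeasurable_toReal hσ).aestronglyMeasurable
      (C * r₀ ^ (s x₀ - Q x₀ / p x₀) * M + |(u y).toReal|) ?_
    filter_upwards [haeF] with x hx
    have h1 := hosc x hx y hy
    have h2 := abs_sub_abs_le_abs_sub (u x).toReal (u y).toReal
    rw [Real.norm_eq_abs]
    linarith
  have hsup : 0 ≤ essSup (fun x => s x - Q x / p x) μ := by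
    have : NeZero μ := ⟨fun h => by
      have := (hst.metricMeasure x₀ r₀ hr).1
      simp [h] at this⟩
    obtain ⟨x, hx⟩ := (ae_le_essSup (μ := μ) (f := fun x => s x - Q x / p x)
      (Filter.isBoundedUnder_of ⟨hi, hE.smoothness_le⟩)).exists
    exact (hαpos x).le.trans hx
  refine ⟨hint, ?_, ?_⟩
  · rw [eLpNorm_exponent_top, ← ENNReal.ofReal_mul (by positivity)]
    refine eLpNormEssSup_le_of_ae_bound ?_
    filter_upwards [haeF] with x hx
    refine abs_sub_average_le hint ?_
    filter_upwards [haeF] with y hy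
    exact hosc x hx y hy
  · obtain ⟨v, hvc, hvF, hvB⟩ := exists_holder_extension
      (hst.metricMeasure.ball_subset_closure hBU hD) hE.logHolder_smoothness.continuous hαpos hF
    refine ⟨v, hvc, ?_, fun x hx y hy => ?_⟩
    · filter_upwards [haeF] with x hx
      rw [hvF x hx, EReal.coe_toReal (huD x hx.1).1 (huD x hx.1).2]
    · have hconst := le_holder_const hsup hC0.le hσ hr hrδ
      have hnn := hC0.le.trans hconst
      rw [← ENNReal.ofReal_mul (mul_nonneg hnn (by positivity))]
      refine ENNReal.ofReal_le_ofReal ((hvB x hx y hy).trans ?_)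
      rw [mul_right_comm]
      exact mul_le_mul_of_nonneg_right (mul_le_mul_of_nonneg_right (hC₁C.trans hconst)
        (by positivity)) hM0

end

end HajlaszVar

/-! ### Constants independent of the measure -/

theorem mainTheorem4 {X : Type*} [MetricSpace X] [MeasurableSpace X] [BorelSpace X]
    (Q p s : X → ℝ) (b δ σ : ℝ) (hb : 0 < b) (hb1 : b ≤ 1) (hδ : 0 < δ) (hσ : 1 < σ)
    (A : HajlaszVar.Scale) :
    -- (i) Sobolev case
    (∃ CS : ℝ, 0 < CS ∧
      ∀ μ : Measure X, HajlaszVar.Standing μ Q p s b δ →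
        HajlaszVar.EssLT μ (fun x => s x * p x) Q →
        ∀ (x₀ : X) (r₀ : ℝ) (q : X → ℝ≥0∞) (u : X → EReal) (g : ℤ → X → ℝ≥0∞),
          HajlaszVar.LocalData A μ s p δ σ x₀ r₀ q u g →
          ∀ γ : X → ℝ, (∀ x, γ x = Q x * p x / (Q x - s x * p x)) →
            (⨅ c : ℝ, HajlaszVar.luxNorm μ (ball x₀ r₀) γ
                (fun x => ENNReal.ofReal |(u x).toReal - c|)) ≤
              ENNReal.ofReal (CS * ((μ (ball x₀ r₀)).toReal / r₀ ^ Q x₀) ^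
                  (1 / essInf γ (μ.restrict (ball x₀ r₀)))) *
                HajlaszVar.mixedNorm A μ (ball x₀ (σ * r₀)) p q g) ∧
    -- (ii) Moser-Trudinger case
    (∃ C1 C2 : ℝ, 0 < C1 ∧ 0 < C2 ∧
      ∀ μ : Measure X, HajlaszVar.Standing μ Q p s b δ →
        (∀ x, s x * p x = Q x) →
        ∀ (x₀ : X) (r₀ : ℝ) (q : X → ℝ≥0∞) (u : X → EReal) (g : ℤ → X → ℝ≥0∞),
          HajlaszVar.LocalData A μ s p δ σ x₀ r₀ q u g →
          0 < HajlaszVar.mixedNorm A μ (ball x₀ (σ * r₀)) p q g →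
            IntegrableOn (fun x => (u x).toReal) (ball x₀ r₀) μ ∧
            (⨍⁻ x in ball x₀ r₀, ENNReal.ofReal (Real.exp
                (C1 * (|(u x).toReal - ⨍ y in ball x₀ r₀, (u y).toReal ∂μ| /
                  (HajlaszVar.mixedNorm A μ (ball x₀ (σ * r₀)) p q g).toReal))) ∂μ) ≤
              ENNReal.ofReal C2) ∧
    -- (iii) Morrey case
    (∃ CH : ℝ, 0 < CH ∧
      ∀ μ : Measure X, HajlaszVar.Standing μ Q p s b δ →
        HajlaszVar.EssLT μ Q (fun x => s x * p x) →
        ∀ (x₀ : X) (r₀ : ℝ) (q : X → ℝ≥0∞) (u : X → EReal) (g : ℤ → X → ℝ≥0∞),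
          HajlaszVar.LocalData A μ s p δ σ x₀ r₀ q u g →
          ∀ α : X → ℝ, (∀ x, α x = s x - Q x / p x) →
            IntegrableOn (fun x => (u x).toReal) (ball x₀ r₀) μ ∧
            eLpNorm (fun x => (u x).toReal - ⨍ y in ball x₀ r₀, (u y).toReal ∂μ) ∞
                (μ.restrict (ball x₀ r₀)) ≤
              ENNReal.ofReal (CH * r₀ ^ α x₀) *
                HajlaszVar.mixedNorm A μ (ball x₀ (σ * r₀)) p q g ∧
            ∃ v : X → ℝ, ContinuousOn v (ball x₀ r₀) ∧
              (∀ᵐ x ∂(μ.restrict (ball x₀ r₀)), u x = (v x : EReal)) ∧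
              ∀ x ∈ ball x₀ r₀, ∀ y ∈ ball x₀ r₀,
                ENNReal.ofReal |v x - v y| ≤
                  ENNReal.ofReal ((2 ^ (essSup α μ + 1) * CH *
                      (σ * δ / ((σ - 1) * r₀)) ^ essSup α μ) * dist x y ^ α x) *
                    HajlaszVar.mixedNorm A μ (ball x₀ (σ * r₀)) p q g) := by
  refine ⟨?_, ?_, ?_⟩
  -- The constants precede `μ`. One admissible measure `ν` yields pointwise information on the
  -- exponents, which then serves every `μ`; if there is none, the claim is vacuous. The other two
  -- cases follow the same pattern.
  · by_cases hex : ∃ μ : Measure X, HajlaszVar.Standing μ Q p s b δ ∧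
        HajlaszVar.EssLT μ (fun x => s x * p x) Q
    · obtain ⟨ν, hν, hlt⟩ := hex
      obtain ⟨lo, hi, hE⟩ := hν.exponents
      obtain ⟨c, hc, hQ⟩ := hlt.forall hν.metricMeasure
        (hν.exponent_s.continuous.mul hν.exponent_p.continuous) hν.exponent_Q.continuous
      obtain ⟨C, hC, H⟩ := hE.sobolev (δ := δ) hb hb1 hσ A hc hQ
      exact ⟨C, hC, fun μ hμ _ => H μ hμ⟩
    · exact ⟨1, one_pos, fun μ hμ hlt => absurd ⟨μ, hμ, hlt⟩ hex⟩
  · by_cases hex : ∃ μ : Measure X, HajlaszVar.Standing μ Q p s b δ ∧ ∀ x, s x * p x = Q x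
    · obtain ⟨ν, hν, hQ⟩ := hex
      obtain ⟨lo, hi, hE⟩ := hν.exponents
      obtain ⟨C₁, C₂, hC₁, hC₂, H⟩ := hE.moserTrudinger (δ := δ) hb hσ A hQ
      exact ⟨C₁, C₂, hC₁, hC₂, fun μ hμ _ => H μ hμ⟩
    · exact ⟨1, 1, one_pos, one_pos, fun μ hμ hQ => absurd ⟨μ, hμ, hQ⟩ hex⟩
  · by_cases hex : ∃ μ : Measure X, HajlaszVar.Standing μ Q p s b δ ∧
        HajlaszVar.EssLT μ Q (fun x => s x * p x)
    · obtain ⟨ν, hν, hlt⟩ := hex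
      obtain ⟨lo, hi, hE⟩ := hν.exponents
      obtain ⟨c, hc, hQ⟩ := hlt.forall hν.metricMeasure hν.exponent_Q.continuous
        (hν.exponent_s.continuous.mul hν.exponent_p.continuous)
      -- The maximum with `1` keeps the lower bound positive even on an empty space, where `hi` has
      -- no sign.
      have hα : ∀ x, c / max hi 1 ≤ s x - Q x / p x := fun x => by
        have hp := hE.p_pos x
        have h1 : p x ≤ max hi 1 := (hE.p_mem x).2.trans (le_max_left _ _)
        calc c / max hi 1 ≤ (s x * p x - Q x) / p x := by
              have := hQ x
              gcongr
              exact hc.le.trans this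
          _ = s x - Q x / p x := by field_simp
      obtain ⟨C, hC, H⟩ := hE.morrey (δ := δ) hb hσ A (by positivity) hα
      exact ⟨C, hC, fun μ hμ _ => H μ hμ⟩
    · exact ⟨1, one_pos, fun μ hμ hlt => absurd ⟨μ, hμ, hlt⟩ hex⟩
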